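/- **Theorem (matrix bounded differences inequality).** Let $n\ge 0$ and $d\ge 1$ be integers. Let $Z_1,\dots,Z_n$ be random variables on a common probability space, $Z_k$ with values in a measurable space $\Lambda_k$, let $Z=(Z_1,\dots,Z_n)$, and let $H$ be a measurable function from $\Lambda_1\times\cdots\times\Lambda_n$ to the complex Hermitian $d\times d$ matrices. Let $A_1,\dots,A_n$ be fixed Hermitian $d\times d$ matrices such that, in the positive semidefinite order, $$\bigl(H(z_1,\dots,z_k,\dots,z_n)-H(z_1,\dots,z_k',\dots,z_n)\bigr)^2\preceq A_k^2$$ for all $k$, all $(z_1,\dots,z_n)\in\Lambda_1\times\cdots\times\Lambda_n$ and all $z_k'\in\Lambda_k$. Put $\sigma^2:=\bigl\|\sum_k A_k^2\bigr\|$ (spectral norm). Then the entries of $H(Z)$ are integrable, so that $\mathbb{E}H(Z)$ exists, and the following hold. 1. If $Z_1,\dots,Z_n$ are independent, then for all $t\ge 0$ $$\mathbb{P}\bigl\{\lambda_{\max}\bigl(H(Z)-\mathbb{E}H(Z)\bigr)\ge t\bigr\}\le d\cdot e^{-t^2/\sigma^2}.$$ 2. Suppose instead that $Z_1,\dots,Z_n$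 are possibly dependent, that the $\Lambda_k$ are standard Borel spaces (for instance Polish spaces with their Borel sets), and that $D=(d_{ij})$ is a Dobrushin interdependence matrix of $Z$ with $\max(\|D\|_1,\|D\|_\infty)<1$, where $\|D\|_1$ is the largest absolute column sum and $\|D\|_\infty$ the largest absolute row sum (both $0$ if $n=0$). Then for all $t\ge 0$ $$\mathbb{P}\bigl\{\lambda_{\max}\bigl(H(Z)-\mathbb{E}H(Z)\bigr)\ge t\bigr\}\le d\cdot e^{-t^2/(c\sigma^2)},\qquad c:=\frac12\left(\frac1{1-\|D\|_1}+\frac1{1-\|D\|_\infty}\right).$$ If $\sigma^2=0$, the right-hand sides are read as $0$ for $t>0$ and as $d$ for $t=0$. Here $D$ is called a Dobrushin interdependence matrix of $Z$ if it is a real $n\times n$ matrix with nonnegative entries and zero diagonal and there are regular conditional distributions $\mu_i(\cdot\mid x_{-i})$ of $Z_i$ given $Z_{-i}=x_{-i}$ (where $x_{-i}$ is $x$ with its $i$-th coordinate deleted), defined for all $x_{-i}$, such that for every $i$ and all $x,y\in\Lambda_1\times\cdots\times\Lambda_n$ $$d_{TV}\bigl(\mu_i(\cdot\mid x_{-i}),\mu_i(\cdot\mid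 y_{-i})\bigr)\le\sum_{j=1}^n d_{ij}\,\mathbf{1}[x_j\ne y_j],\qquad d_{TV}(\mu,\nu)=\sup_B|\mu(B)-\nu(B)|,$$ the supremum being over all measurable sets $B$. -/

import Mathlib

open MeasureTheory ProbabilityTheory
open scoped ComplexOrder

noncomputable section

/-- The largest eigenvalue of a Hermitian complex matrix (of positive size): the supremum of its
real spectrum, which for a Hermitian matrix is its finite set of eigenvalues. -/
def lambdaMax {d : ℕ} (M : Matrix (Fin d) (Fin d) ℂ) : ℝ :=
  sSup (spectrum ℝ M)

/-- The spectral norm of a complex matrix: its operator norm on `ℂ^d` with the Euclidean norm. -/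
def specNorm {d : ℕ} (M : Matrix (Fin d) (Fin d) ℂ) : ℝ :=
  ‖Matrix.toEuclideanCLM (n := Fin d) (𝕜 := ℂ) M‖

/-- The (entrywise) expectation of a random matrix. -/
def matrixExpectation {Ω : Type*} [MeasurableSpace Ω] {d : ℕ}
    (P : Measure Ω) (X : Ω → Matrix (Fin d) (Fin d) ℂ) : Matrix (Fin d) (Fin d) ℂ :=
  Matrix.of fun i j => ∫ ω, X ω i j ∂P

/-- The operator norm of a real matrix on `ℓ¹`: the largest absolute column sum. -/
def normOne {n : ℕ} (D : Matrix (Fin n) (Fin n) ℝ) : ℝ :=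
  ⨆ j, ∑ i, |D i j|

/-- The operator norm of a real matrix on `ℓ^∞`: the largest absolute row sum. -/
def normInf {n : ℕ} (D : Matrix (Fin n) (Fin n) ℝ) : ℝ :=
  ⨆ i, ∑ j, |D i j|

/-- The total variation distance of two probability measures: the supremum of
`|μ(B) - ν(B)|` over all measurable sets `B`. -/
def dTV {α : Type*} [MeasurableSpace α] (μ ν : Measure α) : ℝ :=
  ⨆ B : {B : Set α // MeasurableSet B}, |μ.real B - ν.real B|

/-- The vector `x` with its `i`-th coordinate deleted. -/
def dropCoord {n : ℕ} {Λ : Fin n → Type*} (i : Fin n) (x : ∀ k, Λ k) :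
    ∀ j : {j : Fin n // j ≠ i}, Λ j :=
  fun j => x j

open Classical in
/-- `D` is a Dobrushin interdependence matrix for the random vector `X = (X_1, …, X_n)`:
its entries are nonnegative, its diagonal is zero and, for a (regular) conditional distribution
`κ i` of `X_i` given the other coordinates, the total variation distance of
`κ i (x_{-i})` and `κ i (y_{-i})` is at most `∑_j D_{ij} 1[x_j ≠ y_j]`, for all `x` and `y`. -/
def IsDobrushinMatrix {Ω : Type*} [MeasurableSpace Ω] {n : ℕ} {Λ : Fin n → Type*}
    [∀ k, MeasurableSpace (Λ k)] (P : Measure Ω) (X : Ω → ∀ k, Λ k)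
    (D : Matrix (Fin n) (Fin n) ℝ) : Prop :=
  (∀ i j, 0 ≤ D i j) ∧ (∀ i, D i i = 0) ∧
  ∃ κ : ∀ i, Kernel (∀ j : {j : Fin n // j ≠ i}, Λ j) (Λ i),
    ∀ i, IsMarkovKernel (κ i) ∧
      HasCondDistrib (fun ω => X ω i) (fun ω => dropCoord i (X ω)) (κ i) P ∧
      ∀ x y : ∀ k, Λ k,
        dTV (κ i (dropCoord i x)) (κ i (dropCoord i y)) ≤
          ∑ j, D i j * (if x j ≠ y j then 1 else 0)

end

/-!
The proof is the method of exchangeable pairs, with the Gibbs sampler as the source of pairs.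

Write `f = H - 𝔼 H(Z)`, a function on the product space whose law `μ` is that of `Z`. Let `E_i`
resample the `i`-th coordinate from its conditional law. Given the other coordinates, the old and
the new value are independent with the same law, so a point `z` with law `μ` and its resampled
version `z'` form an exchangeable pair (`pairLaw_map_swap`). If `h` solves the Poisson equation `∑
i, (h - E_i h) = f`, then exchangeability gives, for `G = exp (θ f)`, `𝔼 tr (f G) = ∑ i, 1/2 𝔼 tr
((h(z) - h(z')) (G(z) - G(z')))`. The left-hand side is the derivative of `θ ↦ 𝔼 tr exp (θ f)`. The
mean value trace inequality `trace_exp_sub_exp_mul_le` bounds the right-hand side by traces of `G`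
against `s (f(z) - f(z'))² + s⁻¹ (h(z) - h(z'))²`. The first square is at most `A_i²` by
hypothesis.

The solution `h` is the sum `n⁻¹ ∑ P^t f` along the random scan Gibbs sampler `P`, truncated at
some time `T`; the truncation error `P^T f` tends to `0` uniformly. No coupling is needed to bound
its increments. For a vector-valued function the oscillation in each coordinate is controlled under
`E_i` by the `i`-th row of the interdependence matrix `D` (`oscLE_resample`), because integrals of
a function against two laws differ by at most its oscillation times their total variation distance.
Applied to `z ↦ f(z) x` for every fixed vector `x`, whose oscillations are at most `‖A_j x‖`, this
gives `‖(h(z) - h(z')) x‖ ≤ ∑ j, w_{ji} ‖A_j x‖` with `w ≤ (I - D)⁻¹` entrywise, and the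
Cauchy-Schwarz inequality turns it into the Loewner bound `posSemidef_poissonSum_increment`. The
row and column sums of `w` are at most `1 / (1 - ‖D‖_∞)` and `1 / (1 - ‖D‖_1)`, so `s = 1 / (1 -
‖D‖_1)` leads to the differential inequality `m'(θ) ≤ θ (c σ² / 2) m(θ)` for the trace moment
generating function (`integral_traceRe_mul_exp_le`), and the matrix Chernoff bound
`measureReal_lambdaMax_le` concludes.

Independent variables are the case `D = 0`, where the conditional laws are constant and `c = 1`.
-/

namespace MatrixBoundedDifferences

open scoped Matrix Matrix.Norms.L2Operator

/-! ### Trace inequalities for the matrix exponential -/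

section Trace

variable {m : Type*} [Fintype m]

lemma trace_mul_re_nonneg {P Q : Matrix m m ℂ} (hP : P.PosSemidef) (hQ : Q.PosSemidef) :
    0 ≤ (P * Q).trace.re := by
  obtain ⟨k, v, rfl⟩ := Matrix.posSemidef_iff_eq_sum_vecMulVec.1 hQ
  rw [Matrix.mul_sum, Matrix.trace_sum, Complex.re_sum]
  refine Finset.sum_nonneg fun i _ => ?_
  rw [Matrix.mul_vecMulVec, Matrix.trace_vecMulVec, dotProduct_comm]
  exact hP.re_dotProduct_nonneg (v i)

/-- The trace against a positive semidefinite matrix is monotone for the Loewner order. -/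
lemma trace_mul_re_mono {G Q R : Matrix m m ℂ} (hG : G.PosSemidef) (hQR : (R - Q).PosSemidef) :
    (G * Q).trace.re ≤ (G * R).trace.re := by
  have := trace_mul_re_nonneg hG hQR
  rw [Matrix.mul_sub, Matrix.trace_sub, Complex.sub_re] at this
  linarith

variable [DecidableEq m]

/-- The spectral decomposition of a Hermitian matrix together with that of its exponential. -/
lemma exists_spectral_exp {A : Matrix m m ℂ} (hA : A.IsHermitian) :
    ∃ (U : Matrix m m ℂ) (a : m → ℝ), Uᴴ * U = 1 ∧ U * Uᴴ = 1 ∧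
      spectrum ℝ A = Set.range a ∧
      A = U * Matrix.diagonal (fun i => (a i : ℂ)) * Uᴴ ∧
      NormedSpace.exp A = U * Matrix.diagonal (fun i => (Real.exp (a i) : ℂ)) * Uᴴ := by
  have h1 : (hA.eigenvectorUnitary : Matrix m m ℂ)ᴴ * (hA.eigenvectorUnitary : Matrix m m ℂ) = 1 :=
    Unitary.coe_star_mul_self _
  have h2 : (hA.eigenvectorUnitary : Matrix m m ℂ) * (hA.eigenvectorUnitary : Matrix m m ℂ)ᴴ = 1 :=
    Unitary.coe_mul_star_self _
  have h3 : A = (hA.eigenvectorUnitary : Matrix m m ℂ) *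
      Matrix.diagonal (fun i => (hA.eigenvalues i : ℂ)) *
        (hA.eigenvectorUnitary : Matrix m m ℂ)ᴴ := by
    conv_lhs => rw [hA.spectral_theorem]
    rfl
  refine ⟨hA.eigenvectorUnitary, hA.eigenvalues, h1, h2,
    hA.spectrum_real_eq_range_eigenvalues, h3, ?_⟩
  have hinv : (hA.eigenvectorUnitary : Matrix m m ℂ)ᴴ =
      (hA.eigenvectorUnitary : Matrix m m ℂ)⁻¹ := (Matrix.inv_eq_right_inv h2).symm
  conv_lhs => rw [h3]
  rw [hinv, Matrix.exp_conj _ _ (IsUnit.of_mul_eq_one _ h2), Matrix.exp_diagonal]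
  congr 3
  ext i
  rw [Pi.coe_exp, Complex.ofReal_exp, Complex.exp_eq_exp_ℂ]

/-- The slope of the exponential is at most the mean of its values at the end points. -/
lemma abs_exp_sub_exp_le (a b : ℝ) :
    |Real.exp a - Real.exp b| ≤ (Real.exp a + Real.exp b) / 2 * |a - b| := by
  have key : ∀ x : ℝ, 0 ≤ x → Real.sinh x ≤ x * Real.cosh x := by
    intro x hx
    have hmono : MonotoneOn (fun x : ℝ => x * Real.cosh x - Real.sinh x) (Set.Ici 0) := by
      apply monotoneOn_of_deriv_nonneg (convex_Ici 0)
      · fun_prop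
      · fun_prop
      · intro y hy
        rw [interior_Ici] at hy
        have : HasDerivAt (fun x : ℝ => x * Real.cosh x - Real.sinh x)
            (1 * Real.cosh y + y * Real.sinh y - Real.cosh y) y :=
          ((hasDerivAt_id y).mul (Real.hasDerivAt_cosh y)).sub (Real.hasDerivAt_sinh y)
        rw [this.deriv]
        have := Real.sinh_nonneg_iff.2 (le_of_lt hy)
        have := mul_nonneg (le_of_lt hy) this
        linarith
    have := hmono (Set.mem_Ici.2 le_rfl) (Set.mem_Ici.2 hx) hx
    simp at this
    linarith
  have key2 : ∀ a b : ℝ, b ≤ a →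
      |Real.exp a - Real.exp b| ≤ (Real.exp a + Real.exp b) / 2 * |a - b| := by
    intro a b hab
    rw [abs_of_nonneg (sub_nonneg.2 (Real.exp_le_exp.2 hab)), abs_of_nonneg (sub_nonneg.2 hab)]
    have h := key ((a - b) / 2) (by linarith)
    have e1 : Real.exp a = Real.exp ((a + b) / 2) * Real.exp ((a - b) / 2) := by
      rw [← Real.exp_add]; ring_nf
    have e2 : Real.exp b = Real.exp ((a + b) / 2) * Real.exp (-((a - b) / 2)) := by
      rw [← Real.exp_add]; ring_nf
    rw [Real.sinh_eq, Real.cosh_eq] at h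
    have := mul_le_mul_of_nonneg_left h (Real.exp_pos ((a + b) / 2)).le
    rw [e1, e2]
    nlinarith [this]
  rcases le_total b a with h | h
  · exact key2 a b h
  · rw [abs_sub_comm, abs_sub_comm a b, add_comm]
    exact key2 b a h

lemma trace_conj_diagonal_mul (U C : Matrix m m ℂ) (a : m → ℂ) :
    (U * Matrix.diagonal a * Uᴴ * C).trace = ∑ i, a i * (Uᴴ * C * U) i i := by
  rw [Matrix.mul_assoc, Matrix.mul_assoc, Matrix.trace_mul_comm, Matrix.mul_assoc, Matrix.trace]
  simp [Matrix.diagonal_mul, Matrix.mul_assoc]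

/-- Mean value trace inequality, proved in a pair of eigenbases of `A` and `B`: with
`S = Uᴴ V` and `T = Vᴴ C U` the left-hand side is `∑ (e^{a i} - e^{b j}) S i j T j i`, and
`(a i - b j) S i j` is the `(i, j)` entry of `Uᴴ (A - B) V`. -/
lemma trace_exp_sub_exp_mul_le {A B C : Matrix m m ℂ} (hA : A.IsHermitian) (hB : B.IsHermitian)
    (hC : C.IsHermitian) {s : ℝ} (hs : 0 < s) :
    ((NormedSpace.exp A - NormedSpace.exp B) * C).trace.re ≤
      1 / 4 * (((NormedSpace.exp A + NormedSpace.exp B) *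
        ((s : ℂ) • (A - B) ^ 2 + ((s⁻¹ : ℝ) : ℂ) • C ^ 2)).trace.re) := by
  obtain ⟨U, a, hU1, hU2, -, hAU, hEA⟩ := exists_spectral_exp hA
  obtain ⟨V, b, hV1, hV2, -, hBV, hEB⟩ := exists_spectral_exp hB
  set S := Uᴴ * V with hS
  set T := Vᴴ * C * U with hT
  set Δ := Uᴴ * (A - B) * V with hΔ
  have hΔS : ∀ i j, Δ i j = ((a i - b j : ℝ) : ℂ) * S i j := by
    intro i j
    have : Δ = Matrix.diagonal (fun i => (a i : ℂ)) * S -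
        S * Matrix.diagonal (fun i => (b i : ℂ)) := by
      rw [hΔ, hS, hAU, hBV, Matrix.mul_sub, Matrix.sub_mul]
      congr 1
      · simp only [← Matrix.mul_assoc, hU1, Matrix.one_mul]
      · simp only [Matrix.mul_assoc, hV1, Matrix.mul_one]
    rw [this]
    simp [Matrix.diagonal_mul, Matrix.mul_diagonal]
    ring
  have hDH : (A - B).IsHermitian := hA.sub hB
  have normsq : ∀ z : ℂ, star z * z = ((‖z‖ ^ 2 : ℝ) : ℂ) := fun z => by
    simpa using Complex.conj_mul' z
  have normsq' : ∀ z : ℂ, z * star z = ((‖z‖ ^ 2 : ℝ) : ℂ) := fun z => by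
    simpa using Complex.mul_conj' z
  have e1 : (NormedSpace.exp A * C).trace = ∑ i, ∑ j, (Real.exp (a i) : ℂ) * (S i j * T j i) := by
    rw [hEA, trace_conj_diagonal_mul]
    refine Finset.sum_congr rfl fun i _ => ?_
    have : Uᴴ * C * U = S * T := by
      rw [hS, hT]
      calc Uᴴ * C * U = Uᴴ * (1 * C) * U := by rw [Matrix.one_mul]
        _ = _ := by rw [← hV2]; simp only [Matrix.mul_assoc]
    rw [this, Matrix.mul_apply, Finset.mul_sum]
  have e2 : (NormedSpace.exp B * C).trace = ∑ i, ∑ j, (Real.exp (b j) : ℂ) * (S i j * T j i) := by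
    rw [hEB, trace_conj_diagonal_mul, Finset.sum_comm]
    refine Finset.sum_congr rfl fun i _ => ?_
    have : Vᴴ * C * V = T * S := by
      rw [hS, hT]
      calc Vᴴ * C * V = Vᴴ * (C * 1) * V := by rw [Matrix.mul_one]
        _ = _ := by rw [← hU2]; simp only [Matrix.mul_assoc]
    rw [this, Matrix.mul_apply, Finset.mul_sum]
    refine Finset.sum_congr rfl fun j _ => by ring
  have e3 : (NormedSpace.exp A * (A - B) ^ 2).trace =
      ∑ i, ∑ j, ((Real.exp (a i) * ‖Δ i j‖ ^ 2 : ℝ) : ℂ) := by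
    rw [hEA, trace_conj_diagonal_mul]
    refine Finset.sum_congr rfl fun i _ => ?_
    have : Uᴴ * (A - B) ^ 2 * U = Δ * Δᴴ := by
      rw [hΔ, Matrix.conjTranspose_mul, Matrix.conjTranspose_mul, hDH.eq,
        Matrix.conjTranspose_conjTranspose, pow_two]
      calc Uᴴ * ((A - B) * (A - B)) * U = Uᴴ * ((A - B) * 1 * (A - B)) * U := by rw [Matrix.mul_one]
        _ = _ := by rw [← hV2]; simp only [Matrix.mul_assoc]
    rw [this, Matrix.mul_apply, Finset.mul_sum]
    refine Finset.sum_congr rfl fun j _ => ?_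
    rw [Matrix.conjTranspose_apply, normsq']
    push_cast; ring
  have e4 : (NormedSpace.exp B * (A - B) ^ 2).trace =
      ∑ i, ∑ j, ((Real.exp (b j) * ‖Δ i j‖ ^ 2 : ℝ) : ℂ) := by
    rw [hEB, trace_conj_diagonal_mul, Finset.sum_comm]
    refine Finset.sum_congr rfl fun i _ => ?_
    have : Vᴴ * (A - B) ^ 2 * V = Δᴴ * Δ := by
      rw [hΔ, Matrix.conjTranspose_mul, Matrix.conjTranspose_mul, hDH.eq,
        Matrix.conjTranspose_conjTranspose, pow_two]
      calc Vᴴ * ((A - B) * (A - B)) * V = Vᴴ * ((A - B) * 1 * (A - B)) * V := by rw [Matrix.mul_one]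
        _ = _ := by rw [← hU2]; simp only [Matrix.mul_assoc]
    rw [this, Matrix.mul_apply, Finset.mul_sum]
    refine Finset.sum_congr rfl fun j _ => ?_
    rw [Matrix.conjTranspose_apply, normsq]
    push_cast; ring
  have e5 : (NormedSpace.exp A * C ^ 2).trace =
      ∑ i, ∑ j, ((Real.exp (a i) * ‖T j i‖ ^ 2 : ℝ) : ℂ) := by
    rw [hEA, trace_conj_diagonal_mul]
    refine Finset.sum_congr rfl fun i _ => ?_
    have : Uᴴ * C ^ 2 * U = Tᴴ * T := by
      rw [hT, Matrix.conjTranspose_mul, Matrix.conjTranspose_mul, hC.eq,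
        Matrix.conjTranspose_conjTranspose, pow_two]
      calc Uᴴ * (C * C) * U = Uᴴ * (C * 1 * C) * U := by rw [Matrix.mul_one]
        _ = _ := by rw [← hV2]; simp only [Matrix.mul_assoc]
    rw [this, Matrix.mul_apply, Finset.mul_sum]
    refine Finset.sum_congr rfl fun j _ => ?_
    rw [Matrix.conjTranspose_apply, normsq]
    push_cast; ring
  have e6 : (NormedSpace.exp B * C ^ 2).trace =
      ∑ i, ∑ j, ((Real.exp (b j) * ‖T j i‖ ^ 2 : ℝ) : ℂ) := by
    rw [hEB, trace_conj_diagonal_mul, Finset.sum_comm]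
    refine Finset.sum_congr rfl fun i _ => ?_
    have : Vᴴ * C ^ 2 * V = T * Tᴴ := by
      rw [hT, Matrix.conjTranspose_mul, Matrix.conjTranspose_mul, hC.eq,
        Matrix.conjTranspose_conjTranspose, pow_two]
      calc Vᴴ * (C * C) * V = Vᴴ * (C * 1 * C) * V := by rw [Matrix.mul_one]
        _ = _ := by rw [← hU2]; simp only [Matrix.mul_assoc]
    rw [this, Matrix.mul_apply, Finset.mul_sum]
    refine Finset.sum_congr rfl fun j _ => ?_
    rw [Matrix.conjTranspose_apply, normsq']
    push_cast; ring
  have lhs : ((NormedSpace.exp A - NormedSpace.exp B) * C).trace.re =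
      ∑ i, ∑ j, (Real.exp (a i) - Real.exp (b j)) * (S i j * T j i).re := by
    rw [Matrix.sub_mul, Matrix.trace_sub, e1, e2, ← Finset.sum_sub_distrib, Complex.re_sum]
    refine Finset.sum_congr rfl fun i _ => ?_
    rw [← Finset.sum_sub_distrib, Complex.re_sum]
    refine Finset.sum_congr rfl fun j _ => ?_
    rw [← sub_mul, ← Complex.ofReal_sub, Complex.re_ofReal_mul]
  have rhs : ((NormedSpace.exp A + NormedSpace.exp B) *
        ((s : ℂ) • (A - B) ^ 2 + ((s⁻¹ : ℝ) : ℂ) • C ^ 2)).trace.re =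
      ∑ i, ∑ j, (Real.exp (a i) + Real.exp (b j)) * (s * ‖Δ i j‖ ^ 2 + s⁻¹ * ‖T j i‖ ^ 2) := by
    rw [Matrix.mul_add, Matrix.mul_smul, Matrix.mul_smul, Matrix.trace_add, Matrix.trace_smul,
      Matrix.trace_smul, Matrix.add_mul, Matrix.add_mul, Matrix.trace_add, Matrix.trace_add,
      e3, e4, e5, e6]
    simp only [← Complex.ofReal_sum, ← Complex.ofReal_add, smul_eq_mul, ← Complex.ofReal_mul,
      Complex.ofReal_re, ← Finset.sum_add_distrib, Finset.mul_sum]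
    refine Finset.sum_congr rfl fun i _ => Finset.sum_congr rfl fun j _ => ?_
    ring
  rw [lhs, rhs, Finset.mul_sum]
  refine Finset.sum_le_sum fun i _ => ?_
  rw [Finset.mul_sum]
  refine Finset.sum_le_sum fun j _ => ?_
  have hn : ‖Δ i j‖ = |a i - b j| * ‖S i j‖ := by
    rw [hΔS, norm_mul, Complex.norm_real, Real.norm_eq_abs]
  have hpos : 0 ≤ Real.exp (a i) + Real.exp (b j) := by positivity
  calc (Real.exp (a i) - Real.exp (b j)) * (S i j * T j i).re
      ≤ |Real.exp (a i) - Real.exp (b j)| * (‖S i j‖ * ‖T j i‖) := by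
        refine (le_abs_self _).trans ?_
        rw [abs_mul, ← norm_mul]
        exact mul_le_mul_of_nonneg_left (Complex.abs_re_le_norm _) (abs_nonneg _)
    _ ≤ ((Real.exp (a i) + Real.exp (b j)) / 2 * |a i - b j|) * (‖S i j‖ * ‖T j i‖) :=
        mul_le_mul_of_nonneg_right (abs_exp_sub_exp_le _ _) (by positivity)
    _ = (Real.exp (a i) + Real.exp (b j)) / 2 * (‖Δ i j‖ * ‖T j i‖) := by rw [hn]; ring
    _ ≤ (Real.exp (a i) + Real.exp (b j)) / 2 *
        ((s * ‖Δ i j‖ ^ 2 + s⁻¹ * ‖T j i‖ ^ 2) / 2) := by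
        refine mul_le_mul_of_nonneg_left ?_ (by positivity)
        have h := mul_nonneg (inv_pos.2 hs).le (sq_nonneg (s * ‖Δ i j‖ - ‖T j i‖))
        have : s⁻¹ * (s * ‖Δ i j‖ - ‖T j i‖) ^ 2 =
            s * ‖Δ i j‖ ^ 2 + s⁻¹ * ‖T j i‖ ^ 2 - 2 * (‖Δ i j‖ * ‖T j i‖) := by
          field_simp; ring
        linarith
    _ = _ := by ring

/-- The exponential of a Hermitian matrix is positive semidefinite. -/
lemma posSemidef_exp {A : Matrix m m ℂ} (hA : A.IsHermitian) :
    (NormedSpace.exp A).PosSemidef := by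
  obtain ⟨U, a, -, -, -, -, hE⟩ := exists_spectral_exp hA
  rw [hE]
  exact (Matrix.PosSemidef.diagonal fun i => 
    Complex.zero_le_real.2 (Real.exp_pos (a i)).le).mul_mul_conjTranspose_same U

end Trace

/-! ### Total variation and oscillation -/

section TotalVariation

variable {α : Type*} [MeasurableSpace α] (μ ν : Measure α) [IsProbabilityMeasure μ]
  [IsProbabilityMeasure ν]

lemma abs_measureReal_sub_le_dTV {B : Set α} (hB : MeasurableSet B) :
    |μ.real B - ν.real B| ≤ dTV μ ν := by
  have hbdd : BddAbove (Set.range fun B : {B : Set α // MeasurableSet B} =>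
      |μ.real B - ν.real B|) := by
    refine ⟨1, ?_⟩
    rintro _ ⟨B, rfl⟩
    have h1 : μ.real (B : Set α) ≤ 1 := measureReal_le_one
    have h2 : ν.real (B : Set α) ≤ 1 := measureReal_le_one
    have h3 : 0 ≤ μ.real (B : Set α) := measureReal_nonneg
    have h4 : 0 ≤ ν.real (B : Set α) := measureReal_nonneg
    exact abs_le.2 ⟨by linarith, by linarith⟩
  exact le_ciSup hbdd ⟨B, hB⟩

lemma abs_integral_sub_integral_le_dTV {f : α → ℝ} (hf : Measurable f) {L : ℝ}
    (hL : ∀ x y, |f x - f y| ≤ L) :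
    |∫ x, f x ∂μ - ∫ x, f x ∂ν| ≤ L * dTV μ ν := by
  have : Nonempty α := nonempty_of_isProbabilityMeasure μ
  obtain ⟨x₀⟩ := this
  have hL0 : 0 ≤ L := (abs_nonneg _).trans (hL x₀ x₀)
  have hbdd : BddBelow (Set.range f) := ⟨f x₀ - L, by
    rintro _ ⟨x, rfl⟩
    have := (abs_le.1 (hL x x₀)).1
    linarith⟩
  have hne : Nonempty α := ⟨x₀⟩
  set a := ⨅ x, f x with ha
  have h0 : ∀ x, 0 ≤ f x - a := fun x => sub_nonneg.2 (ciInf_le hbdd x)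
  have h1 : ∀ x, f x - a ≤ L := fun x => by
    have : f x - L ≤ a := le_ciInf fun y => by
      have := (abs_le.1 (hL x y)).2
      linarith
    linarith
  have layer : ∀ (ρ : Measure α) [IsProbabilityMeasure ρ],
      Integrable (fun x => f x - a) ρ ∧
      ∫ x, f x ∂ρ = a + ∫ t in Set.Ioc 0 L, ρ.real {x | t ≤ f x - a} := by
    intro ρ _
    have hint : Integrable (fun x => f x - a) ρ := by
      refine Integrable.of_bound (hf.sub_const a).aestronglyMeasurable L ?_
      filter_upwards with x
      rw [Real.norm_eq_abs, abs_of_nonneg (h0 x)]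
      exact h1 x
    refine ⟨hint, ?_⟩
    rw [← hint.integral_eq_integral_Ioc_meas_le (Filter.Eventually.of_forall h0)
      (Filter.Eventually.of_forall h1)]
    have hf' : Integrable f ρ := by simpa [Pi.add_def] using hint.add (integrable_const a)
    rw [integral_sub hf' (integrable_const a)]
    simp
  have hi : ∀ (ρ : Measure α) [IsProbabilityMeasure ρ],
      IntegrableOn (fun t => ρ.real {x | t ≤ f x - a}) (Set.Ioc 0 L) := by
    intro ρ _
    have hanti : Antitone fun t => ρ.real {x | t ≤ f x - a} := fun s t hst =>
      measureReal_mono fun x (hx : t ≤ f x - a) => hst.trans hx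
    exact ((hanti.antitoneOn _).integrableOn_isCompact isCompact_Icc).mono_set
      Set.Ioc_subset_Icc_self
  rw [(layer μ).2, (layer ν).2, add_sub_add_left_eq_sub, ← integral_sub (hi μ) (hi ν)]
  have := norm_setIntegral_le_of_norm_le_const (μ := volume) (s := Set.Ioc 0 L)
    (f := fun t => μ.real {x | t ≤ f x - a} - ν.real {x | t ≤ f x - a}) (C := dTV μ ν)
    (by simp) (fun t _ => abs_measureReal_sub_le_dTV μ ν
      (measurableSet_le measurable_const (hf.sub_const a)))
  simpa [hL0, mul_comm] using this

/-- The scalar estimate passes to values in a normed space by testing against a norming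
functional. -/
lemma norm_integral_sub_integral_le_dTV {V : Type*} [NormedAddCommGroup V] [NormedSpace ℝ V]
    [CompleteSpace V] {f : α → V} (hf : StronglyMeasurable f) {L : ℝ}
    (hL : ∀ x y, ‖f x - f y‖ ≤ L) :
    ‖∫ x, f x ∂μ - ∫ x, f x ∂ν‖ ≤ L * dTV μ ν := by
  obtain ⟨x₀⟩ := nonempty_of_isProbabilityMeasure μ
  have hint : ∀ (ρ : Measure α) [IsProbabilityMeasure ρ], Integrable f ρ := fun ρ _ => by
    refine Integrable.of_bound hf.aestronglyMeasurable (L + ‖f x₀‖) ?_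
    filter_upwards with x
    calc ‖f x‖ = ‖(f x - f x₀) + f x₀‖ := by simp
      _ ≤ L + ‖f x₀‖ := (norm_add_le _ _).trans (by gcongr; exact hL _ _)
  obtain ⟨g, hg1, hg2⟩ := exists_dual_vector'' ℝ (∫ x, f x ∂μ - ∫ x, f x ∂ν)
  have h := abs_integral_sub_integral_le_dTV μ ν (f := fun x => g (f x)) (L := L)
    (g.continuous.comp_stronglyMeasurable hf).measurable (fun x y => by
      rw [← map_sub, ← Real.norm_eq_abs]
      exact (g.le_of_opNorm_le hg1 _).trans (by simpa using hL x y))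
  rw [g.integral_comp_comm (hint μ), g.integral_comp_comm (hint ν), ← map_sub, hg2] at h
  exact (le_abs_self _).trans h

end TotalVariation

/-! ### Gibbs resampling operators -/

section Gibbs

variable {n : ℕ} {Λ : Fin n → Type*} {V W : Type*} [NormedAddCommGroup V] [NormedAddCommGroup W]

lemma dropCoord_update (i : Fin n) (z : ∀ k, Λ k) (y : Λ i) :
    dropCoord i (Function.update z i y) = dropCoord i z := by
  funext j
  exact Function.update_of_ne j.2 _ _

/-- The function `f` changes by at most `δ k` in norm when the `k`-th coordinate is changed. -/
def OscLE (f : (∀ k, Λ k) → V) (δ : Fin n → ℝ) : Prop :=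
  ∀ (k : Fin n) (z : ∀ k, Λ k) (y : Λ k), ‖f z - f (Function.update z k y)‖ ≤ δ k

/-- Two points are joined by changing one coordinate at a time. -/
lemma OscLE.norm_sub_le {f : (∀ k, Λ k) → V} {δ : Fin n → ℝ} (h : OscLE f δ)
    (z z' : ∀ k, Λ k) : ‖f z - f z'‖ ≤ ∑ k, δ k := by
  classical
  -- `z` with the coordinates in `s` replaced by those of `z'`
  have key : ∀ s : Finset (Fin n), ‖f z - f (fun k => if k ∈ s then z' k else z k)‖ ≤
      ∑ k ∈ s, δ k := by
    intro s
    induction s using Finset.induction_on with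
    | empty => simp
    | insert a s ha ih =>
      rw [Finset.sum_insert ha, add_comm]
      have e : (fun k => if k ∈ insert a s then z' k else z k) =
          Function.update (fun k => if k ∈ s then z' k else z k) a (z' a) := by
        funext k
        by_cases hk : k = a
        · subst hk; simp
        · simp [hk]
      rw [e]
      calc _ = ‖(f z - f (fun k => if k ∈ s then z' k else z k)) +
            (f (fun k => if k ∈ s then z' k else z k) -
              f (Function.update (fun k => if k ∈ s then z' k else z k) a (z' a)))‖ := by simp
        _ ≤ _ := (norm_add_le _ _).trans (add_le_add ih (h _ _ _))
  simpa using key Finset.univ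

lemma OscLE.exists_norm_le {f : (∀ k, Λ k) → V} {δ : Fin n → ℝ} (h : OscLE f δ) :
    ∃ C, ∀ z, ‖f z‖ ≤ C := by
  rcases isEmpty_or_nonempty (∀ k, Λ k) with he | ⟨⟨z₀⟩⟩
  · exact ⟨0, fun z => he.elim z⟩
  · refine ⟨∑ k, δ k + ‖f z₀‖, fun z => ?_⟩
    calc ‖f z‖ = ‖(f z - f z₀) + f z₀‖ := by rw [sub_add_cancel]
      _ ≤ _ := (norm_add_le _ _).trans (by gcongr; exact h.norm_sub_le z z₀)

variable [∀ k, MeasurableSpace (Λ k)]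

lemma measurable_dropCoord (i : Fin n) : Measurable (dropCoord (Λ := Λ) i) :=
  measurable_pi_lambda _ fun j => measurable_pi_apply (j : Fin n)

lemma stronglyMeasurable_comp_update {f : (∀ k, Λ k) → V} (hf : StronglyMeasurable f) (i : Fin n)
    (z : ∀ k, Λ k) : StronglyMeasurable fun y => f (Function.update z i y) :=
  hf.comp_measurable (measurable_update z)

lemma integrable_comp_update {f : (∀ k, Λ k) → V} (hf : StronglyMeasurable f) {C : ℝ}
    (hC : ∀ z, ‖f z‖ ≤ C) (i : Fin n) (z : ∀ k, Λ k) (ρ : Measure (Λ i)) [IsFiniteMeasure ρ] :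
    Integrable (fun y => f (Function.update z i y)) ρ :=
  Integrable.of_bound (stronglyMeasurable_comp_update hf i z).aestronglyMeasurable C
    (Filter.Eventually.of_forall fun _ => hC _)

variable [NormedSpace ℝ V] [NormedSpace ℝ W]
  (κ : ∀ i, Kernel (∀ j : {j : Fin n // j ≠ i}, Λ j) (Λ i))

/-- Resampling of the `i`-th coordinate from `κ i`: the operator
`f ↦ (z ↦ ∫ f(z_1, …, y, …, z_n) κ_i(dy | z_{-i}))`. -/
noncomputable def resample (i : Fin n) (f : (∀ k, Λ k) → V) (z : ∀ k, Λ k) : V :=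
  ∫ y, f (Function.update z i y) ∂κ i (dropCoord i z)

variable {κ} [∀ i, IsMarkovKernel (κ i)]

lemma stronglyMeasurable_resample (i : Fin n) {f : (∀ k, Λ k) → V} (hf : StronglyMeasurable f) :
    StronglyMeasurable (resample κ i f) := by
  have := (hf.comp_measurable (measurable_update' (X := Λ) (a := i))).integral_kernel_prod_right'
    (κ := (κ i).comap (dropCoord i) (measurable_dropCoord i))
  exact this

lemma norm_resample_le {f : (∀ k, Λ k) → V} {C : ℝ} (hC : ∀ z, ‖f z‖ ≤ C)
    (i : Fin n) (z : ∀ k, Λ k) : ‖resample κ i f z‖ ≤ C := by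
  have := norm_integral_le_of_norm_le_const (μ := κ i (dropCoord i z))
    (f := fun y => f (Function.update z i y)) (C := C) (Filter.Eventually.of_forall fun _ => hC _)
  simpa [resample] using this

lemma resample_comp_continuousLinearMap [CompleteSpace V] [CompleteSpace W] (φ : V →L[ℝ] W)
    (i : Fin n) {f : (∀ k, Λ k) → V} (hf : StronglyMeasurable f) {C : ℝ} (hC : ∀ z, ‖f z‖ ≤ C) :
    resample κ i (fun z => φ (f z)) = fun z => φ (resample κ i f z) := by
  funext z
  exact φ.integral_comp_comm (integrable_comp_update hf hC i z _)

/-- Resampling the `i`-th coordinate removes the oscillation in that coordinate and passes it on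
to the other coordinates through the `i`-th row of the interdependence matrix. -/
lemma oscLE_resample [CompleteSpace V] {D : Matrix (Fin n) (Fin n) ℝ} (hD : ∀ i j, 0 ≤ D i j)
    (i : Fin n)
    (hTV : ∀ (z : ∀ k, Λ k) (k : Fin n) (y : Λ k), k ≠ i →
      dTV (κ i (dropCoord i z)) (κ i (dropCoord i (Function.update z k y))) ≤ D i k)
    {f : (∀ k, Λ k) → V} (hf : StronglyMeasurable f) {δ : Fin n → ℝ} (hδ : ∀ k, 0 ≤ δ k)
    {C : ℝ} (hC : ∀ z, ‖f z‖ ≤ C) (h : OscLE f δ) :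
    OscLE (resample κ i f) (fun k => (if k = i then 0 else δ k) + D i k * δ i) := by
  intro k z y
  by_cases hk : k = i
  · subst hk
    have e : resample κ k f (Function.update z k y) =
        resample κ k f z := by
      simp only [resample, dropCoord_update, Function.update_idem]
    rw [e]
    simpa only [sub_self, norm_zero, if_pos, zero_add] using mul_nonneg (hD k k) (hδ k)
  · set z' := Function.update z k y with hz'
    set ρ := κ i (dropCoord i z)
    set ρ' := κ i (dropCoord i z')
    have h1 : ‖∫ x, f (Function.update z i x) ∂ρ - ∫ x, f (Function.update z' i x) ∂ρ‖ ≤ δ k := by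
      rw [← integral_sub (integrable_comp_update hf hC i z _)
        (integrable_comp_update hf hC i z' _)]
      have := norm_integral_le_of_norm_le_const (μ := ρ)
        (f := fun x => f (Function.update z i x) - f (Function.update z' i x)) (C := δ k)
        (Filter.Eventually.of_forall fun x => by
          rw [hz', Function.update_comm hk]
          exact h k _ _)
      simpa using this
    have h2 : ‖∫ x, f (Function.update z' i x) ∂ρ - ∫ x, f (Function.update z' i x) ∂ρ'‖ ≤
        D i k * δ i := by
      refine (norm_integral_sub_integral_le_dTV ρ ρ' (stronglyMeasurable_comp_update hf i z')
        (L := δ i) (fun x x' => ?_)).trans ?_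
      · have := h i (Function.update z' i x) x'
        rwa [Function.update_idem] at this
      · rw [mul_comm]
        exact mul_le_mul_of_nonneg_right (hTV z k y hk) (hδ i)
    calc _ = ‖(∫ x, f (Function.update z i x) ∂ρ - ∫ x, f (Function.update z' i x) ∂ρ) +
        (∫ x, f (Function.update z' i x) ∂ρ - ∫ x, f (Function.update z' i x) ∂ρ')‖ := by
          simp only [resample, sub_add_sub_cancel]; rfl
      _ ≤ δ k + D i k * δ i := (norm_add_le _ _).trans (add_le_add h1 h2)
      _ = _ := by simp only [if_neg hk]

end Gibbs

/-! ### Powers of the interdependence matrix of the Gibbs sampler -/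

section GibbsMatrix

variable {n : ℕ} {D : Matrix (Fin n) (Fin n) ℝ}

/-- The matrix `(1 - 1/n) I + D/n` that bounds how one step of the random scan Gibbs sampler
propagates oscillations. -/
noncomputable def gibbsMatrix (D : Matrix (Fin n) (Fin n) ℝ) : Matrix (Fin n) (Fin n) ℝ :=
  (1 - (n : ℝ)⁻¹) • (1 : Matrix (Fin n) (Fin n) ℝ) + (n : ℝ)⁻¹ • D

/-- The normalised partial sum `n⁻¹ ∑_{t < T} B ^ t` of the Neumann series of
`n⁻¹ (I - B)⁻¹ = (I - D)⁻¹`, where `B = gibbsMatrix D`. -/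
noncomputable def neumannSum (D : Matrix (Fin n) (Fin n) ℝ) (T : ℕ) : Matrix (Fin n) (Fin n) ℝ :=
  (n : ℝ)⁻¹ • ∑ t ∈ Finset.range T, gibbsMatrix D ^ t

lemma gibbsMatrix_transpose (D : Matrix (Fin n) (Fin n) ℝ) :
    (gibbsMatrix D)ᵀ = gibbsMatrix Dᵀ := by
  simp [gibbsMatrix, Matrix.transpose_add, Matrix.transpose_smul]

lemma neumannSum_transpose (D : Matrix (Fin n) (Fin n) ℝ) (T : ℕ) :
    (neumannSum D T)ᵀ = neumannSum Dᵀ T := by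
  simp [neumannSum, Matrix.transpose_smul, Matrix.transpose_sum, Matrix.transpose_pow,
    gibbsMatrix_transpose]

lemma gibbsMatrix_pow_nonneg (hD : ∀ i j, 0 ≤ D i j) (t : ℕ) (i j : Fin n) :
    0 ≤ (gibbsMatrix D ^ t) i j := by
  have hB : ∀ i j, 0 ≤ gibbsMatrix D i j := by
    intro i j
    have hn : (1 : ℝ) ≤ n := by exact_mod_cast (Nat.one_le_iff_ne_zero.2 i.pos.ne')
    have h1 : (n : ℝ)⁻¹ ≤ 1 := inv_le_one_of_one_le₀ hn
    have h2 : 0 ≤ (n : ℝ)⁻¹ * D i j := mul_nonneg (by positivity) (hD i j)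
    by_cases hij : i = j
    · subst hij; simp [gibbsMatrix]; linarith
    · simpa [gibbsMatrix, hij] using h2
  induction t generalizing i j with
  | zero => by_cases hij : i = j <;> simp [hij]
  | succ t ih =>
    rw [pow_succ, Matrix.mul_apply]
    exact Finset.sum_nonneg fun k _ => mul_nonneg (ih i k) (hB k j)

lemma neumannSum_nonneg (hD : ∀ i j, 0 ≤ D i j) (T : ℕ) (i j : Fin n) :
    0 ≤ neumannSum D T i j := by
  simp only [neumannSum, Matrix.smul_apply, Matrix.sum_apply, smul_eq_mul]
  exact mul_nonneg (by positivity) (Finset.sum_nonneg fun t _ => gibbsMatrix_pow_nonneg hD t i j)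

lemma sum_gibbsMatrix_pow_le (hD : ∀ i j, 0 ≤ D i j) {r : ℝ} (hr0 : 0 ≤ r)
    (hr : ∀ i, ∑ j, D i j ≤ r) (t : ℕ) (i : Fin n) :
    ∑ j, (gibbsMatrix D ^ t) i j ≤ (1 - (1 - r) / n) ^ t := by
  induction t generalizing i with
  | zero => simp [Matrix.one_apply]
  | succ t ih =>
    have hn : (1 : ℝ) ≤ n := by exact_mod_cast (Nat.one_le_iff_ne_zero.2 i.pos.ne')
    have hrow : ∀ k, ∑ j, gibbsMatrix D k j ≤ 1 - (1 - r) / n := by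
      intro k
      have : ∑ j, gibbsMatrix D k j = (1 - (n : ℝ)⁻¹) + (n : ℝ)⁻¹ * ∑ j, D k j := by
        simp [gibbsMatrix, Finset.sum_add_distrib, Matrix.one_apply, Finset.mul_sum]
      rw [this]
      have := mul_le_mul_of_nonneg_left (hr k) (by positivity : 0 ≤ (n : ℝ)⁻¹)
      calc _ ≤ (1 - (n : ℝ)⁻¹) + (n : ℝ)⁻¹ * r := by linarith
        _ = _ := by ring
    have hρ : 0 ≤ 1 - (1 - r) / n := by
      have : (1 - r) / n ≤ 1 := by rw [div_le_one (by linarith)]; linarith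
      linarith
    calc ∑ j, (gibbsMatrix D ^ (t + 1)) i j
        = ∑ k, (gibbsMatrix D ^ t) i k * ∑ j, gibbsMatrix D k j := by
          simp only [pow_succ, Matrix.mul_apply, Finset.mul_sum]
          rw [Finset.sum_comm]
      _ ≤ ∑ k, (gibbsMatrix D ^ t) i k * (1 - (1 - r) / n) :=
          Finset.sum_le_sum fun k _ =>
            mul_le_mul_of_nonneg_left (hrow k) (gibbsMatrix_pow_nonneg hD t i k)
      _ ≤ (1 - (1 - r) / n) ^ t * (1 - (1 - r) / n) := by
          rw [← Finset.sum_mul]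
          exact mul_le_mul_of_nonneg_right (ih i) hρ
      _ = _ := (pow_succ _ _).symm

/-- Row sums of the truncated Neumann series. The bound on column sums follows by transposition. -/
lemma sum_neumannSum_le (hD : ∀ i j, 0 ≤ D i j) {r : ℝ} (hr0 : 0 ≤ r) (hr1 : r < 1)
    (hr : ∀ i, ∑ j, D i j ≤ r) (T : ℕ) (i : Fin n) :
    ∑ j, neumannSum D T i j ≤ 1 / (1 - r) := by
  have hn : (1 : ℝ) ≤ n := by exact_mod_cast (Nat.one_le_iff_ne_zero.2 i.pos.ne')
  set ρ := 1 - (1 - r) / n with hρ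
  have hρ0 : 0 ≤ ρ := by
    have : (1 - r) / n ≤ 1 := by rw [div_le_one (by linarith)]; linarith
    linarith
  have h1 : ∑ j, neumannSum D T i j ≤ (n : ℝ)⁻¹ * ∑ t ∈ Finset.range T, ρ ^ t := by
    simp only [neumannSum, Matrix.smul_apply, Matrix.sum_apply, smul_eq_mul]
    rw [← Finset.mul_sum, Finset.sum_comm]
    exact mul_le_mul_of_nonneg_left
      (Finset.sum_le_sum fun t _ => sum_gibbsMatrix_pow_le hD hr0 hr t i) (by positivity)
  have h2 : (1 - r) * ((n : ℝ)⁻¹ * ∑ t ∈ Finset.range T, ρ ^ t) ≤ 1 := by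
    have := mul_neg_geom_sum ρ T
    have e : 1 - ρ = (1 - r) * (n : ℝ)⁻¹ := by rw [hρ]; ring
    rw [← mul_assoc, ← e, this]
    have := pow_nonneg hρ0 T
    linarith
  rw [le_div_iff₀ (by linarith)]
  calc _ ≤ ((n : ℝ)⁻¹ * ∑ t ∈ Finset.range T, ρ ^ t) * (1 - r) :=
        mul_le_mul_of_nonneg_right h1 (by linarith)
    _ ≤ 1 := by linarith

lemma sum_le_normInf (D : Matrix (Fin n) (Fin n) ℝ) (i : Fin n) : ∑ j, D i j ≤ normInf D :=
  (Finset.sum_le_sum fun _ _ => le_abs_self _).trans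
    (le_ciSup (f := fun i => ∑ j, |D i j|) (Set.finite_range _).bddAbove i)

lemma normInf_nonneg (D : Matrix (Fin n) (Fin n) ℝ) : 0 ≤ normInf D :=
  Real.iSup_nonneg fun _ => Finset.sum_nonneg fun _ _ => abs_nonneg _

lemma normInf_transpose (D : Matrix (Fin n) (Fin n) ℝ) : normInf Dᵀ = normOne D := rfl

end GibbsMatrix

/-! ### The random scan Gibbs sampler and the Poisson equation -/

section GibbsSampler

variable {n : ℕ} {Λ : Fin n → Type*} [∀ k, MeasurableSpace (Λ k)]
  {V W : Type*} [NormedAddCommGroup V] [NormedAddCommGroup W] [NormedSpace ℝ V] [NormedSpace ℝ W]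
  (κ : ∀ i, Kernel (∀ j : {j : Fin n // j ≠ i}, Λ j) (Λ i))

/-- The transition operator of the random scan Gibbs sampler: a uniformly random coordinate is
resampled. -/
noncomputable def gibbsStep (f : (∀ k, Λ k) → V) (z : ∀ k, Λ k) : V :=
  (n : ℝ)⁻¹ • ∑ i, resample κ i f z

/-- The partial sum `n⁻¹ ∑_{t < T} P ^ t f`, an approximate solution `h` of the Poisson equation
`∑ i, (h - E_i h) = f`, where `E_i` is `resample κ i` and `P` is `gibbsStep κ`. -/
noncomputable def poissonSum (f : (∀ k, Λ k) → V) (T : ℕ) (z : ∀ k, Λ k) : V :=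
  (n : ℝ)⁻¹ • ∑ t ∈ Finset.range T, ((gibbsStep κ)^[t] f) z

variable {κ} [∀ i, IsMarkovKernel (κ i)]

lemma stronglyMeasurable_gibbsStep_iterate {f : (∀ k, Λ k) → V} (hf : StronglyMeasurable f)
    (t : ℕ) : StronglyMeasurable ((gibbsStep κ)^[t] f) := by
  induction t with
  | zero => exact hf
  | succ t ih =>
    rw [Function.iterate_succ_apply']
    exact (Finset.stronglyMeasurable_fun_sum _
      fun i _ => stronglyMeasurable_resample i ih).const_smul _

lemma norm_gibbsStep_iterate_le {f : (∀ k, Λ k) → V} {C : ℝ} (hC : ∀ z, ‖f z‖ ≤ C) (t : ℕ)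
    (z : ∀ k, Λ k) : ‖((gibbsStep κ)^[t] f) z‖ ≤ C := by
  induction t generalizing z with
  | zero => exact hC z
  | succ t ih =>
    rw [Function.iterate_succ_apply', gibbsStep, norm_smul, Real.norm_of_nonneg (by positivity)]
    have h0 : 0 ≤ C := (norm_nonneg _).trans (hC z)
    rcases Nat.eq_zero_or_pos n with hn | hn
    · simpa [hn] using h0
    · have : ‖∑ i, resample κ i ((gibbsStep κ)^[t] f) z‖ ≤ n * C := by
        refine (norm_sum_le_of_le (f := fun i => resample κ i ((gibbsStep κ)^[t] f) z) _
          fun i _ => norm_resample_le ih i z).trans ?_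
        simp
      calc _ ≤ (n : ℝ)⁻¹ * (n * C) := by gcongr
        _ = C := by field_simp

lemma gibbsStep_iterate_comp_continuousLinearMap [CompleteSpace V] [CompleteSpace W]
    (φ : V →L[ℝ] W) {f : (∀ k, Λ k) → V} (hf : StronglyMeasurable f) {C : ℝ}
    (hC : ∀ z, ‖f z‖ ≤ C) (t : ℕ) :
    (gibbsStep κ)^[t] (fun z => φ (f z)) = fun z => φ ((gibbsStep κ)^[t] f z) := by
  induction t with
  | zero => rfl
  | succ t ih =>
    rw [Function.iterate_succ_apply', Function.iterate_succ_apply', ih]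
    funext z
    simp only [gibbsStep]
    rw [map_smul, map_sum]
    congr 1
    refine Finset.sum_congr rfl fun i _ => ?_
    rw [resample_comp_continuousLinearMap φ i (stronglyMeasurable_gibbsStep_iterate hf t)
      (norm_gibbsStep_iterate_le hC t)]

/-- The hypothesis on total variation distances for configurations that differ in one
coordinate. -/
def DobrushinLE (κ : ∀ i, Kernel (∀ j : {j : Fin n // j ≠ i}, Λ j) (Λ i))
    (D : Matrix (Fin n) (Fin n) ℝ) : Prop :=
  ∀ (i : Fin n) (z : ∀ k, Λ k) (k : Fin n) (y : Λ k), k ≠ i →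
    dTV (κ i (dropCoord i z)) (κ i (dropCoord i (Function.update z k y))) ≤ D i k

lemma oscLE_gibbsStep_iterate [CompleteSpace V] {D : Matrix (Fin n) (Fin n) ℝ}
    (hD : ∀ i j, 0 ≤ D i j) (hTV : DobrushinLE κ D)
    {f : (∀ k, Λ k) → V} (hf : StronglyMeasurable f) {δ : Fin n → ℝ} (hδ : ∀ k, 0 ≤ δ k)
    {C : ℝ} (hC : ∀ z, ‖f z‖ ≤ C) (h : OscLE f δ) (t : ℕ) :
    OscLE ((gibbsStep κ)^[t] f) (δ ᵥ* gibbsMatrix D ^ t) := by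
  induction t with
  | zero => simpa using h
  | succ t ih =>
    intro k z y
    have hn : (n : ℝ) ≠ 0 := Nat.cast_ne_zero.2 k.pos.ne'
    set δ' := δ ᵥ* gibbsMatrix D ^ t with hδ'
    have hδ'0 : ∀ k, 0 ≤ δ' k := fun k => by
      rw [hδ']
      simp only [Matrix.vecMul, dotProduct]
      exact Finset.sum_nonneg fun j _ => mul_nonneg (hδ j) (gibbsMatrix_pow_nonneg hD t j k)
    rw [Function.iterate_succ_apply', gibbsStep, gibbsStep, ← smul_sub, ← Finset.sum_sub_distrib,
      norm_smul, Real.norm_of_nonneg (by positivity)]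
    calc _ ≤ (n : ℝ)⁻¹ * ∑ i, ((if k = i then 0 else δ' k) + D i k * δ' i) := by
          gcongr
          exact norm_sum_le_of_le _ fun i _ => oscLE_resample hD i (hTV i)
            (stronglyMeasurable_gibbsStep_iterate hf t) hδ'0
            (norm_gibbsStep_iterate_le hC t) ih k z y
      _ = (δ' ᵥ* gibbsMatrix D) k := by
          have e1 : ∑ i, (if k = i then 0 else δ' k) = (n - 1) * δ' k := by
            have : ∀ i, (if k = i then 0 else δ' k) = δ' k - (if k = i then δ' k else 0) :=
              fun i => by split_ifs <;> simp
            simp only [this, Finset.sum_sub_distrib]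
            simp; ring
          have e2 : (δ' ᵥ* gibbsMatrix D) k =
              (1 - (n : ℝ)⁻¹) * δ' k + (n : ℝ)⁻¹ * ∑ i, δ' i * D i k := by
            rw [gibbsMatrix, Matrix.vecMul_add, Matrix.vecMul_smul, Matrix.vecMul_smul,
              Matrix.vecMul_one]
            rfl
          rw [Finset.sum_add_distrib, e1, e2]
          simp only [mul_comm (D _ k)]
          field_simp
      _ = _ := by rw [pow_succ, ← Matrix.vecMul_vecMul]

lemma oscLE_poissonSum [CompleteSpace V] {D : Matrix (Fin n) (Fin n) ℝ}
    (hD : ∀ i j, 0 ≤ D i j) (hTV : DobrushinLE κ D)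
    {f : (∀ k, Λ k) → V} (hf : StronglyMeasurable f) {δ : Fin n → ℝ} (hδ : ∀ k, 0 ≤ δ k)
    {C : ℝ} (hC : ∀ z, ‖f z‖ ≤ C) (h : OscLE f δ) (T : ℕ) :
    OscLE (poissonSum κ f T) (δ ᵥ* neumannSum D T) := by
  intro k z y
  rw [poissonSum, poissonSum, ← smul_sub, ← Finset.sum_sub_distrib, norm_smul,
    Real.norm_of_nonneg (by positivity), neumannSum, Matrix.vecMul_smul, Pi.smul_apply,
    smul_eq_mul, Matrix.vecMul_sum, Finset.sum_apply]
  gcongr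
  exact norm_sum_le_of_le _ fun t _ => oscLE_gibbsStep_iterate hD hTV hf hδ hC h t k z y

lemma stronglyMeasurable_poissonSum {f : (∀ k, Λ k) → V} (hf : StronglyMeasurable f) (T : ℕ) :
    StronglyMeasurable (poissonSum κ f T) :=
  (Finset.stronglyMeasurable_fun_sum _
    fun t _ => stronglyMeasurable_gibbsStep_iterate hf t).const_smul _

lemma norm_poissonSum_le {f : (∀ k, Λ k) → V} {C : ℝ} (hC : ∀ z, ‖f z‖ ≤ C) (T : ℕ)
    (z : ∀ k, Λ k) : ‖poissonSum κ f T z‖ ≤ (n : ℝ)⁻¹ * (T * C) := by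
  rw [poissonSum, norm_smul, Real.norm_of_nonneg (by positivity)]
  gcongr
  refine (norm_sum_le_of_le _ fun t _ => norm_gibbsStep_iterate_le hC t z).trans ?_
  simp

lemma poissonSum_comp_continuousLinearMap [CompleteSpace V] [CompleteSpace W]
    (φ : V →L[ℝ] W) {f : (∀ k, Λ k) → V} (hf : StronglyMeasurable f) {C : ℝ}
    (hC : ∀ z, ‖f z‖ ≤ C) (T : ℕ) :
    poissonSum κ (fun z => φ (f z)) T = fun z => φ (poissonSum κ f T z) := by
  funext z
  simp only [poissonSum, map_smul, map_sum, gibbsStep_iterate_comp_continuousLinearMap φ hf hC]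

lemma sum_poissonSum_sub_resample [CompleteSpace V] (hn : n ≠ 0) {f : (∀ k, Λ k) → V}
    (hf : StronglyMeasurable f) {C : ℝ} (hC : ∀ z, ‖f z‖ ≤ C) (T : ℕ) (z : ∀ k, Λ k) :
    ∑ i, (poissonSum κ f T z - resample κ i (poissonSum κ f T) z) =
      f z - ((gibbsStep κ)^[T] f) z := by
  have hn' : (n : ℝ) ≠ 0 := Nat.cast_ne_zero.2 hn
  have e : ∀ i, resample κ i (poissonSum κ f T) z =
      (n : ℝ)⁻¹ • ∑ t ∈ Finset.range T, resample κ i ((gibbsStep κ)^[t] f) z := by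
    intro i
    simp only [resample, poissonSum]
    rw [integral_smul, integral_finsetSum]
    exact fun t _ => integrable_comp_update (stronglyMeasurable_gibbsStep_iterate hf t)
      (norm_gibbsStep_iterate_le hC t) i z _
  have e2 : ∀ t, (n : ℝ)⁻¹ • ∑ i, resample κ i ((gibbsStep κ)^[t] f) z =
      ((gibbsStep κ)^[t + 1] f) z := fun t => by
    rw [Function.iterate_succ_apply']; rfl
  simp only [Finset.sum_sub_distrib, e]
  rw [← Finset.smul_sum, Finset.sum_comm, Finset.smul_sum]
  simp only [e2]
  rw [Finset.sum_const, Finset.card_univ, Fintype.card_fin, poissonSum, ← Nat.cast_smul_eq_nsmul ℝ,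
    smul_smul, mul_inv_cancel₀ hn', one_smul, ← Finset.sum_sub_distrib,
    Finset.sum_range_sub']
  rfl

/-! ### Exchangeable pairs from resampling -/

variable (κ) in
/-- The joint law of `(Z, Z')` where `Z` has law `μ` and `Z'` arises from `Z` by resampling the
`i`-th coordinate. -/
noncomputable def pairLaw (μ : Measure (∀ k, Λ k)) (i : Fin n) :
    Measure ((∀ k, Λ k) × (∀ k, Λ k)) :=
  (μ ⊗ₘ (κ i).comap (dropCoord i) (measurable_dropCoord i)).map
    fun p => (p.1, Function.update p.1 i p.2)

lemma measurable_prod_update (i : Fin n) :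
    Measurable fun p : (∀ k, Λ k) × Λ i => (p.1, Function.update p.1 i p.2) :=
  measurable_fst.prodMk measurable_update'

variable {μ : Measure (∀ k, Λ k)} [IsProbabilityMeasure μ]

instance (i : Fin n) : IsProbabilityMeasure (pairLaw κ μ i) :=
  Measure.isProbabilityMeasure_map (measurable_prod_update i).aemeasurable

lemma lintegral_pairLaw (i : Fin n) {F : (∀ k, Λ k) × (∀ k, Λ k) → ENNReal} (hF : Measurable F) :
    ∫⁻ p, F p ∂pairLaw κ μ i =
      ∫⁻ z, ∫⁻ y, F (z, Function.update z i y) ∂κ i (dropCoord i z) ∂μ := by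
  rw [pairLaw, lintegral_map hF (measurable_prod_update i),
    Measure.lintegral_compProd (f := fun p => F (p.1, Function.update p.1 i p.2))
      (hF.comp (measurable_prod_update i))]
  rfl

lemma integral_pairLaw (i : Fin n) {F : (∀ k, Λ k) × (∀ k, Λ k) → V} (hF : StronglyMeasurable F)
    {C : ℝ} (hC : ∀ p, ‖F p‖ ≤ C) :
    ∫ p, F p ∂pairLaw κ μ i =
      ∫ z, ∫ y, F (z, Function.update z i y) ∂κ i (dropCoord i z) ∂μ := by
  rw [pairLaw, integral_map (measurable_prod_update i).aemeasurable hF.aestronglyMeasurable,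
    Measure.integral_compProd]
  · rfl
  · exact Integrable.of_bound
      (hF.comp_measurable (measurable_prod_update i)).aestronglyMeasurable C
      (Filter.Eventually.of_forall fun _ => hC _)

/-- If `κ i` is the conditional law of the `i`-th coordinate given the others, then the old and
the new value of that coordinate are conditionally i.i.d., so the pair is exchangeable. -/
lemma pairLaw_map_swap (i : Fin n)
    (hμ : μ.map (fun z => (dropCoord i z, z i)) = μ.map (dropCoord i) ⊗ₘ κ i) :
    (pairLaw κ μ i).map Prod.swap = pairLaw κ μ i := by
  obtain ⟨z₀⟩ := nonempty_of_isProbabilityMeasure μ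
  -- `glue w x` is the point with `i`-th coordinate `x` and other coordinates `w`; the base point
  -- `z₀` only serves to fill a slot that is overwritten at once
  let glue : (∀ j : {j : Fin n // j ≠ i}, Λ j) → Λ i → ∀ k, Λ k := fun w x =>
    Function.update (fun j => if h : j ≠ i then w ⟨j, h⟩ else z₀ j) i x
  have hglue : Measurable fun p : (∀ j : {j : Fin n // j ≠ i}, Λ j) × Λ i => glue p.1 p.2 := by
    have hbase : ∀ j, Measurable fun p : (∀ j : {j : Fin n // j ≠ i}, Λ j) × Λ i =>
        if h : j ≠ i then p.1 ⟨j, h⟩ else z₀ j := fun j => by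
      by_cases h : j ≠ i
      · simp only [dif_pos h]
        exact (measurable_pi_apply (X := fun j : {j : Fin n // j ≠ i} => Λ j) ⟨j, h⟩).comp
          measurable_fst
      · simp only [dif_neg h]
        exact measurable_const
    exact (measurable_update' (a := i)).comp
      ((measurable_pi_lambda _ hbase).prodMk measurable_snd)
  have hupd : ∀ w x y, Function.update (glue w x) i y = glue w y := fun w x y => by
    simp [glue]
  have hid : ∀ z, glue (dropCoord i z) (z i) = z := fun z => by
    funext j
    by_cases h : j = i
    · subst h; simp [glue]
    · simp [glue, h, dropCoord]
  have key : ∀ F : (∀ k, Λ k) × (∀ k, Λ k) → ENNReal, Measurable F →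
      ∫⁻ p, F p ∂pairLaw κ μ i = ∫⁻ w, ∫⁻ x, ∫⁻ y, F (glue w x, glue w y) ∂κ i w ∂κ i w
        ∂μ.map (dropCoord i) := by
    intro F hF
    have hm : Measurable fun p : (∀ j : {j : Fin n // j ≠ i}, Λ j) × Λ i =>
        ∫⁻ y, F (glue p.1 p.2, glue p.1 y) ∂κ i p.1 := by
      refine Measurable.lintegral_kernel_prod_right'
        (κ := (κ i).comap Prod.fst measurable_fst)
        (f := fun q : ((∀ j : {j : Fin n // j ≠ i}, Λ j) × Λ i) × Λ i =>
          F (glue q.1.1 q.1.2, glue q.1.1 q.2)) ?_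
      exact hF.comp ((hglue.comp measurable_fst).prodMk
        (hglue.comp ((measurable_fst.comp measurable_fst).prodMk measurable_snd)))
    rw [lintegral_pairLaw i hF, ← Measure.lintegral_compProd hm, ← hμ,
      lintegral_map hm ((measurable_dropCoord i).prodMk (measurable_pi_apply i))]
    refine lintegral_congr fun z => ?_
    rw [hid]
    refine lintegral_congr fun y => ?_
    rw [← hupd _ (z i) y, hid]
  refine Measure.ext_of_lintegral _ fun F hF => ?_
  rw [lintegral_map hF measurable_swap, key (fun p => F p.swap) (hF.comp measurable_swap), key F hF]
  refine lintegral_congr fun w => ?_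
  rw [lintegral_lintegral_swap]
  · rfl
  · refine (hF.comp measurable_swap).comp_aemeasurable (Measurable.aemeasurable ?_)
    exact (hglue.comp (measurable_const.prodMk measurable_fst)).prodMk
      (hglue.comp (measurable_const.prodMk measurable_snd))

lemma integral_pairLaw_swap (i : Fin n)
    (hμ : μ.map (fun z => (dropCoord i z, z i)) = μ.map (dropCoord i) ⊗ₘ κ i)
    {F : (∀ k, Λ k) × (∀ k, Λ k) → V} (hF : StronglyMeasurable F) :
    ∫ p, F p.swap ∂pairLaw κ μ i = ∫ p, F p ∂pairLaw κ μ i := by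
  conv_rhs => rw [← pairLaw_map_swap i hμ]
  rw [integral_map measurable_swap.aemeasurable hF.aestronglyMeasurable]

lemma integral_resample (i : Fin n)
    (hμ : μ.map (fun z => (dropCoord i z, z i)) = μ.map (dropCoord i) ⊗ₘ κ i)
    {f : (∀ k, Λ k) → V} (hf : StronglyMeasurable f) {C : ℝ} (hC : ∀ z, ‖f z‖ ≤ C)
    [CompleteSpace V] :
    ∫ z, resample κ i f z ∂μ = ∫ z, f z ∂μ := by
  have h1 := integral_pairLaw (κ := κ) (μ := μ) i (F := fun p => f p.2)
    (hf.comp_measurable measurable_snd) (fun p => hC p.2)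
  have h2 := integral_pairLaw (κ := κ) (μ := μ) i (F := fun p => f p.1)
    (hf.comp_measurable measurable_fst) (fun p => hC p.1)
  have h3 := integral_pairLaw_swap i hμ (F := fun p => f p.1) (hf.comp_measurable measurable_fst)
  simp only [Prod.fst_swap, integral_const, probReal_univ, one_smul] at h1 h2 h3
  rw [← h2, ← h3, h1]
  rfl

/-- Under the Dobrushin condition the Gibbs sampler forgets its starting point geometrically
fast. -/
lemma norm_gibbsStep_iterate_le_of_integral_eq_zero [CompleteSpace V]
    (hμ : ∀ i, μ.map (fun z => (dropCoord i z, z i)) = μ.map (dropCoord i) ⊗ₘ κ i)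
    {D : Matrix (Fin n) (Fin n) ℝ} (hD : ∀ i j, 0 ≤ D i j) (hTV : DobrushinLE κ D)
    {f : (∀ k, Λ k) → V} (hf : StronglyMeasurable f) {δ : Fin n → ℝ} (hδ : ∀ k, 0 ≤ δ k)
    {C : ℝ} (hC : ∀ z, ‖f z‖ ≤ C) (h : OscLE f δ) (h0 : ∫ z, f z ∂μ = 0) (t : ℕ)
    (z : ∀ k, Λ k) :
    ‖((gibbsStep κ)^[t] f) z‖ ≤ (1 - (1 - normInf D) / n) ^ t * ∑ k, δ k := by
  have hn : ∀ k : Fin n, (n : ℝ) ≠ 0 := fun k => Nat.cast_ne_zero.2 k.pos.ne'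
  have hint : ∀ t, Integrable ((gibbsStep κ)^[t] f) μ := fun t =>
    Integrable.of_bound (stronglyMeasurable_gibbsStep_iterate hf t).aestronglyMeasurable C
      (Filter.Eventually.of_forall (norm_gibbsStep_iterate_le hC t))
  have hzero : ∫ z, ((gibbsStep κ)^[t] f) z ∂μ = 0 := by
    induction t with
    | zero => exact h0
    | succ t ih =>
      simp only [Function.iterate_succ_apply', gibbsStep]
      rw [integral_smul, integral_finsetSum]
      · simp [integral_resample _ (hμ _) (stronglyMeasurable_gibbsStep_iterate hf t)
          (norm_gibbsStep_iterate_le hC t), ih]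
      · exact fun i _ => Integrable.of_bound (stronglyMeasurable_resample i
          (stronglyMeasurable_gibbsStep_iterate hf t)).aestronglyMeasurable C
          (Filter.Eventually.of_forall (norm_resample_le (norm_gibbsStep_iterate_le hC t) i))
  have e : ((gibbsStep κ)^[t] f) z =
      ∫ z', (((gibbsStep κ)^[t] f) z - ((gibbsStep κ)^[t] f) z') ∂μ := by
    rw [integral_sub (integrable_const _) (hint t), hzero]
    simp
  rw [e]
  refine (norm_integral_le_of_norm_le_const (Filter.Eventually.of_forall fun z' =>
    (oscLE_gibbsStep_iterate hD hTV hf hδ hC h t).norm_sub_le z z')).trans ?_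
  simp only [probReal_univ, mul_one, Matrix.vecMul, dotProduct]
  rw [Finset.sum_comm, Finset.mul_sum]
  refine Finset.sum_le_sum fun j _ => ?_
  rw [← Finset.mul_sum, mul_comm]
  exact mul_le_mul_of_nonneg_right
    (sum_gibbsMatrix_pow_le hD (normInf_nonneg D) (sum_le_normInf D) t j) (hδ j)

end GibbsSampler

/-! ### Loewner order and Euclidean norms -/

section Loewner

variable {m : Type*}

lemma isHermitian_real_smul {M : Matrix m m ℂ} (hM : M.IsHermitian) (θ : ℝ) :
    (θ • M).IsHermitian := by
  rw [Matrix.IsHermitian, Matrix.conjTranspose_smul, hM.eq]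
  simp

variable [Fintype m]

/-- The real part of the trace as a continuous real-linear functional. -/
noncomputable def traceRe : Matrix m m ℂ →L[ℝ] ℝ :=
  LinearMap.toContinuousLinearMap (Complex.reLm ∘ₗ Matrix.traceLinearMap m ℝ ℂ)

lemma traceRe_apply (M : Matrix m m ℂ) : traceRe M = M.trace.re := rfl

lemma traceRe_mul_comm (M N : Matrix m m ℂ) : traceRe (M * N) = traceRe (N * M) := by
  rw [traceRe_apply, traceRe_apply, Matrix.trace_mul_comm]

variable [DecidableEq m]

lemma abs_traceRe_mul_le (M N : Matrix m m ℂ) :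
    |traceRe (M * N)| ≤ ‖(traceRe : Matrix m m ℂ →L[ℝ] ℝ)‖ * (‖M‖ * ‖N‖) := by
  rw [← Real.norm_eq_abs]
  have h := ContinuousLinearMap.le_opNorm (traceRe : Matrix m m ℂ →L[ℝ] ℝ) (M * N)
  exact h.trans (mul_le_mul_of_nonneg_left (norm_mul_le M N) (norm_nonneg _))

/-- Evaluation `M ↦ M x` of a matrix at a vector, with values in Euclidean space. -/
noncomputable def evalCLM (x : EuclideanSpace ℂ m) : Matrix m m ℂ →L[ℝ] EuclideanSpace ℂ m :=
  LinearMap.toContinuousLinearMap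
    { toFun := fun M => Matrix.toEuclideanCLM (n := m) (𝕜 := ℂ) M x
      map_add' := fun M N => by simp
      map_smul' := fun c M => by
        rw [← Complex.coe_smul, map_smul]
        simp }

lemma evalCLM_apply (x : EuclideanSpace ℂ m) (M : Matrix m m ℂ) :
    evalCLM x M = Matrix.toEuclideanCLM (n := m) (𝕜 := ℂ) M x := rfl

lemma norm_evalCLM_le (x : EuclideanSpace ℂ m) (M : Matrix m m ℂ) :
    ‖evalCLM x M‖ ≤ ‖M‖ * ‖x‖ := by
  rw [← Matrix.l2_opNorm_toEuclideanCLM M]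
  exact ContinuousLinearMap.le_opNorm (Matrix.toEuclideanCLM (n := m) (𝕜 := ℂ) M) x

lemma dotProduct_sq_mulVec {M : Matrix m m ℂ} (hM : M.IsHermitian) (x : m → ℂ) :
    star x ⬝ᵥ (M ^ 2 *ᵥ x) = ((‖evalCLM (WithLp.toLp 2 x) M‖ ^ 2 : ℝ) : ℂ) := by
  rw [pow_two, ← Matrix.mulVec_mulVec, Matrix.dotProduct_mulVec]
  have h : star x ᵥ* M = star (M *ᵥ x) := by rw [Matrix.star_mulVec, hM.eq]
  rw [h, evalCLM_apply, Matrix.toEuclideanCLM_toLp, EuclideanSpace.norm_sq_eq, dotProduct]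
  push_cast
  exact Finset.sum_congr rfl fun i _ => by simpa using Complex.conj_mul' ((M *ᵥ x) i)

lemma norm_evalCLM_le_of_posSemidef {A M : Matrix m m ℂ} (hA : A.IsHermitian)
    (hM : M.IsHermitian) (h : (A ^ 2 - M ^ 2).PosSemidef) (x : EuclideanSpace ℂ m) :
    ‖evalCLM x M‖ ≤ ‖evalCLM x A‖ := by
  have := h.dotProduct_mulVec_nonneg (WithLp.ofLp x)
  rw [Matrix.sub_mulVec, dotProduct_sub, dotProduct_sq_mulVec hA, dotProduct_sq_mulVec hM,
    ← Complex.ofReal_sub, Complex.zero_le_real] at this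
  exact (pow_le_pow_iff_left₀ (norm_nonneg _) (norm_nonneg _) two_ne_zero).1 (sub_nonneg.1 this)

lemma norm_le_of_posSemidef {A M : Matrix m m ℂ} (hA : A.IsHermitian)
    (hM : M.IsHermitian) (h : (A ^ 2 - M ^ 2).PosSemidef) : ‖M‖ ≤ ‖A‖ := by
  rw [← Matrix.l2_opNorm_toEuclideanCLM M]
  exact ContinuousLinearMap.opNorm_le_bound _ (norm_nonneg _) fun x =>
    (norm_evalCLM_le_of_posSemidef hA hM h x).trans (norm_evalCLM_le x A)

/-- Operator convexity of the square, in the form supplied by oscillation bounds for the vectors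
`C x`. -/
lemma posSemidef_sum_smul_sq_sub_sq {ι : Type*} [Fintype ι] {A : ι → Matrix m m ℂ}
    (hA : ∀ j, (A j).IsHermitian) {C : Matrix m m ℂ} (hC : C.IsHermitian) {p : ι → ℝ}
    (hp : ∀ j, 0 ≤ p j) {q : ℝ} (hq : ∑ j, p j ≤ q)
    (h : ∀ x, ‖evalCLM x C‖ ≤ ∑ j, p j * ‖evalCLM x (A j)‖) :
    ((∑ j, ((q * p j : ℝ) : ℂ) • A j ^ 2) - C ^ 2).PosSemidef := by
  have hherm : (∑ j, ((q * p j : ℝ) : ℂ) • A j ^ 2).IsHermitian := by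
    rw [Matrix.IsHermitian, Matrix.conjTranspose_sum]
    refine Finset.sum_congr rfl fun j _ => ?_
    rw [Matrix.conjTranspose_smul, ((hA j).pow 2).eq]
    simp
  refine Matrix.PosSemidef.of_dotProduct_mulVec_nonneg (hherm.sub (hC.pow 2)) fun x => ?_
  rw [Matrix.sub_mulVec, dotProduct_sub, dotProduct_sq_mulVec hC, Matrix.sum_mulVec,
    dotProduct_sum]
  simp only [Matrix.smul_mulVec, dotProduct_smul, dotProduct_sq_mulVec (hA _), smul_eq_mul,
    ← Complex.ofReal_mul, ← Complex.ofReal_sum, ← Complex.ofReal_sub]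
  rw [Complex.zero_le_real, sub_nonneg]
  set y : EuclideanSpace ℂ m := WithLp.toLp 2 x
  have hcs : (∑ j, p j * ‖evalCLM y (A j)‖) ^ 2 ≤
      (∑ j, p j) * ∑ j, p j * ‖evalCLM y (A j)‖ ^ 2 := by
    have := Finset.sum_sq_le_sum_mul_sum_of_sq_le_mul Finset.univ (fun j _ => hp j)
      (fun j _ => mul_nonneg (hp j) (sq_nonneg ‖evalCLM y (A j)‖))
      (r := fun j => p j * ‖evalCLM y (A j)‖) (fun j _ => by apply le_of_eq; ring)
    exact this
  calc ‖evalCLM y C‖ ^ 2 ≤ (∑ j, p j * ‖evalCLM y (A j)‖) ^ 2 :=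
        pow_le_pow_left₀ (norm_nonneg _) (h y) 2
    _ ≤ (∑ j, p j) * ∑ j, p j * ‖evalCLM y (A j)‖ ^ 2 := hcs
    _ ≤ q * ∑ j, p j * ‖evalCLM y (A j)‖ ^ 2 :=
        mul_le_mul_of_nonneg_right hq
          (Finset.sum_nonneg fun j _ => mul_nonneg (hp j) (sq_nonneg _))
    _ = _ := by
        rw [Finset.mul_sum]
        exact Finset.sum_congr rfl fun j _ => by ring

lemma traceRe_mul_le_norm {G M : Matrix m m ℂ} (hG : G.PosSemidef) (hM : M.IsHermitian) :
    traceRe (G * M) ≤ ‖M‖ * traceRe G := by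
  have hps : (((‖M‖ : ℝ) : ℂ) • (1 : Matrix m m ℂ) - M).PosSemidef := by
    refine Matrix.PosSemidef.of_dotProduct_mulVec_nonneg ?_ fun x => ?_
    · refine Matrix.IsHermitian.sub ?_ hM
      rw [Matrix.IsHermitian, Matrix.conjTranspose_smul]
      simp
    · have him : (star x ⬝ᵥ (M *ᵥ x)).im = 0 := hM.im_star_dotProduct_mulVec_self x
      set y : EuclideanSpace ℂ m := WithLp.toLp 2 x with hy
      have e1 : star x ⬝ᵥ (M *ᵥ x) = inner ℂ y (evalCLM y M) := by
        rw [evalCLM_apply, hy, Matrix.toEuclideanCLM_toLp, EuclideanSpace.inner_eq_star_dotProduct,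
          dotProduct_comm]
      have e2 : star x ⬝ᵥ x = ((‖y‖ ^ 2 : ℝ) : ℂ) := by
        rw [EuclideanSpace.norm_sq_eq, dotProduct]
        push_cast
        exact Finset.sum_congr rfl fun i _ => by simpa using Complex.conj_mul' (x i)
      have e3 : (star x ⬝ᵥ (M *ᵥ x)).re ≤ ‖M‖ * ‖y‖ ^ 2 := by
        rw [e1]
        calc _ ≤ ‖y‖ * ‖evalCLM y M‖ := re_inner_le_norm (𝕜 := ℂ) y _
          _ ≤ ‖y‖ * (‖M‖ * ‖y‖) := by
            gcongr
            exact norm_evalCLM_le y M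
          _ = _ := by ring
      have e4 : star x ⬝ᵥ (M *ᵥ x) = (((star x ⬝ᵥ (M *ᵥ x)).re : ℝ) : ℂ) :=
        Complex.ext rfl (by simpa using him)
      rw [Matrix.sub_mulVec, dotProduct_sub, Matrix.smul_mulVec, Matrix.one_mulVec,
        dotProduct_smul, e2, smul_eq_mul, ← Complex.ofReal_mul, e4, ← Complex.ofReal_sub,
        Complex.zero_le_real]
      linarith
  have := trace_mul_re_mono hG hps
  rw [Matrix.mul_smul, Matrix.mul_one, Matrix.trace_smul, smul_eq_mul,
    Complex.re_ofReal_mul] at this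
  exact this

lemma continuous_exp : Continuous (NormedSpace.exp : Matrix m m ℂ → Matrix m m ℂ) := by
  let : NormedAlgebra ℚ (Matrix m m ℂ) := NormedAlgebra.restrictScalars ℚ ℂ _
  exact NormedSpace.exp_continuous

lemma exists_norm_exp_le (r : ℝ) :
    ∃ K, ∀ M : Matrix m m ℂ, ‖M‖ ≤ r → ‖NormedSpace.exp M‖ ≤ K := by
  have : ProperSpace (Matrix m m ℂ) := FiniteDimensional.proper ℂ _
  obtain ⟨K, hK⟩ := (isCompact_closedBall (0 : Matrix m m ℂ) r).exists_bound_of_continuousOn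
    (f := NormedSpace.exp) continuous_exp.continuousOn
  exact ⟨K, fun M hM => hK M (by simpa using hM)⟩

/-- Laplace transform bound for the largest eigenvalue. -/
lemma exp_mul_le_traceRe_exp {d : ℕ} (hd : 1 ≤ d) {M : Matrix (Fin d) (Fin d) ℂ}
    (hM : M.IsHermitian) {θ t : ℝ} (hθ : 0 ≤ θ) (ht : t ≤ lambdaMax M) :
    Real.exp (θ * t) ≤ traceRe (NormedSpace.exp (θ • M)) := by
  have : Nonempty (Fin d) := ⟨⟨0, hd⟩⟩
  have hmem : lambdaMax M ∈ spectrum ℝ M := by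
    refine Set.Nonempty.csSup_mem ?_ Matrix.finite_real_spectrum
    rw [hM.spectrum_real_eq_range_eigenvalues]
    exact Set.range_nonempty _
  obtain ⟨U, a, hU, -, hspec, -, hE⟩ := exists_spectral_exp (isHermitian_real_smul hM θ)
  have hmem' : θ * lambdaMax M ∈ spectrum ℝ (θ • M) := by
    rcases hθ.eq_or_lt with h0 | h0
    · rw [← h0, zero_smul, zero_mul, spectrum.zero_eq]
      rfl
    · have := (spectrum.smul_mem_smul_iff (r := Units.mk0 θ h0.ne') (a := M)).2 hmem
      exact this
  rw [hspec] at hmem'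
  obtain ⟨i, hi⟩ := hmem'
  have htr : traceRe (NormedSpace.exp (θ • M)) = ∑ i, Real.exp (a i) := by
    rw [traceRe_apply, hE, Matrix.trace_mul_comm, ← Matrix.mul_assoc, hU, Matrix.one_mul,
      Matrix.trace_diagonal, ← Complex.ofReal_sum, Complex.ofReal_re]
  rw [htr]
  calc Real.exp (θ * t) ≤ Real.exp (a i) := by
        rw [hi]; exact Real.exp_le_exp.2 (mul_le_mul_of_nonneg_left ht hθ)
    _ ≤ _ := Finset.single_le_sum (f := fun i => Real.exp (a i))
        (fun j _ => (Real.exp_pos _).le) (Finset.mem_univ i)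

end Loewner

/-! ### The trace moment generating function -/

section TraceMgf

variable {m : Type*} [Fintype m] [DecidableEq m] {E : Type*} [MeasurableSpace E]
  {μ : Measure E} [IsProbabilityMeasure μ] {f : E → Matrix m m ℂ}

/-- The trace moment generating function `θ ↦ 𝔼 tr exp (θ f)`. -/
noncomputable def traceMgf (μ : Measure E) (f : E → Matrix m m ℂ) (θ : ℝ) : ℝ :=
  ∫ z, traceRe (NormedSpace.exp (θ • f z)) ∂μ

lemma stronglyMeasurable_exp_smul (hf : StronglyMeasurable f) (θ : ℝ) :
    StronglyMeasurable fun z => NormedSpace.exp (θ • f z) :=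
  continuous_exp.comp_stronglyMeasurable (hf.const_smul θ)

lemma integrable_traceRe_mul {F G : E → Matrix m m ℂ} (hF : StronglyMeasurable F)
    (hG : StronglyMeasurable G) {C K : ℝ} (hC : ∀ z, ‖F z‖ ≤ C) (hK : ∀ z, ‖G z‖ ≤ K) :
    Integrable (fun z => traceRe (F z * G z)) μ := by
  refine Integrable.of_bound
    (traceRe.continuous.comp_stronglyMeasurable (hF.mul hG)).aestronglyMeasurable
    (‖(traceRe : Matrix m m ℂ →L[ℝ] ℝ)‖ * (C * K)) (Filter.Eventually.of_forall fun z => ?_)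
  refine (abs_traceRe_mul_le _ _).trans ?_
  have := (norm_nonneg _).trans (hC z)
  gcongr
  exacts [hC z, hK z]

lemma hasDerivAt_traceMgf (hf : StronglyMeasurable f) {C : ℝ} (hC : ∀ z, ‖f z‖ ≤ C) (θ : ℝ) :
    HasDerivAt (traceMgf μ f) (∫ z, traceRe (f z * NormedSpace.exp (θ • f z)) ∂μ) θ := by
  obtain ⟨z₀⟩ := nonempty_of_isProbabilityMeasure μ
  have hC0 : 0 ≤ C := (norm_nonneg _).trans (hC z₀)
  obtain ⟨K, hK⟩ := exists_norm_exp_le (m := m) ((|θ| + 1) * C)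
  have hbound : ∀ x ∈ Metric.ball θ 1, ∀ z, ‖NormedSpace.exp (x • f z)‖ ≤ K := by
    intro x hx z
    refine hK _ ?_
    rw [norm_smul, Real.norm_eq_abs]
    have : |x| ≤ |θ| + 1 := by
      rw [Metric.mem_ball, Real.dist_eq] at hx
      have := abs_sub_abs_le_abs_sub x θ
      linarith
    gcongr
    exact hC z
  refine (hasDerivAt_integral_of_dominated_loc_of_deriv_le
    (bound := fun _ => ‖(traceRe : Matrix m m ℂ →L[ℝ] ℝ)‖ * (C * K))
    (F := fun θ z => traceRe (NormedSpace.exp (θ • f z)))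
    (F' := fun θ z => traceRe (f z * NormedSpace.exp (θ • f z)))
    (Metric.ball_mem_nhds θ one_pos) ?_ ?_ ?_ ?_ (integrable_const _) ?_).2
  · exact Filter.Eventually.of_forall fun x =>
      (traceRe.continuous.comp_stronglyMeasurable
        (stronglyMeasurable_exp_smul hf x)).aestronglyMeasurable
  · have := integrable_traceRe_mul (μ := μ) (F := fun _ => 1) stronglyMeasurable_const
      (stronglyMeasurable_exp_smul hf θ) (fun _ => le_rfl)
      (hbound θ (Metric.mem_ball_self one_pos))
    simpa using this
  · exact (traceRe.continuous.comp_stronglyMeasurable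
      (hf.mul (stronglyMeasurable_exp_smul hf θ))).aestronglyMeasurable
  · refine Filter.Eventually.of_forall fun z x hx => ?_
    refine (abs_traceRe_mul_le _ _).trans ?_
    gcongr
    exacts [hC z, hbound x hx z]
  · refine Filter.Eventually.of_forall fun z x _ => ?_
    exact traceRe.hasFDerivAt.comp_hasDerivAt x (hasDerivAt_exp_smul_const' (f z) x)

/-- Integration of the differential inequality `M' ≤ θ v M` for the trace moment generating
function. -/
lemma traceMgf_le_of_deriv_le (hf : StronglyMeasurable f) {C : ℝ} (hC : ∀ z, ‖f z‖ ≤ C) {v : ℝ}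
    (h : ∀ θ, 0 < θ →
      ∫ z, traceRe (f z * NormedSpace.exp (θ • f z)) ∂μ ≤ θ * v * traceMgf μ f θ)
    {θ : ℝ} (hθ : 0 ≤ θ) :
    traceMgf μ f θ ≤ Fintype.card m * Real.exp (v * θ ^ 2 / 2) := by
  have hder : ∀ θ, HasDerivAt (fun θ => traceMgf μ f θ * Real.exp (-(v * θ ^ 2 / 2)))
      ((∫ z, traceRe (f z * NormedSpace.exp (θ • f z)) ∂μ) * Real.exp (-(v * θ ^ 2 / 2)) +
        traceMgf μ f θ * (Real.exp (-(v * θ ^ 2 / 2)) * (-(v * θ)))) θ := by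
    intro θ
    refine (hasDerivAt_traceMgf hf hC θ).mul (HasDerivAt.exp ?_)
    have h2 : HasDerivAt (fun θ : ℝ => -(v * θ ^ 2 / 2)) (-(v * (2 * θ) / 2)) θ := by
      have h3 := (((hasDerivAt_pow 2 θ).const_mul v).div_const 2).fun_neg
      simpa using h3
    exact h2.congr_deriv (by ring)
  have hanti : AntitoneOn (fun θ => traceMgf μ f θ * Real.exp (-(v * θ ^ 2 / 2)))
      (Set.Ici 0) := by
    refine antitoneOn_of_deriv_nonpos (convex_Ici 0)
      (fun θ _ => (hder θ).continuousAt.continuousWithinAt)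
      (fun θ _ => (hder θ).differentiableAt.differentiableWithinAt) fun θ hθ => ?_
    rw [interior_Ici] at hθ
    rw [(hder θ).deriv]
    have := mul_le_mul_of_nonneg_right (h θ hθ) (Real.exp_pos (-(v * θ ^ 2 / 2))).le
    linarith
  have h0 := hanti (Set.mem_Ici.2 le_rfl) (Set.mem_Ici.2 hθ) hθ
  have e0 : traceMgf μ f 0 = Fintype.card m := by
    simp [traceMgf, traceRe_apply]
  simp only [e0] at h0
  have h1 : traceMgf μ f θ * Real.exp (-(v * θ ^ 2 / 2)) ≤ Fintype.card m := by simpa using h0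
  have := mul_le_mul_of_nonneg_right h1 (Real.exp_pos (v * θ ^ 2 / 2)).le
  rwa [mul_assoc, ← Real.exp_add, neg_add_cancel, Real.exp_zero, mul_one] at this

/-- The matrix Chernoff bound with a sub-Gaussian trace moment generating function. -/
lemma measureReal_lambdaMax_le {d : ℕ} (hd : 1 ≤ d) {f : E → Matrix (Fin d) (Fin d) ℂ}
    (hf : StronglyMeasurable f) (hherm : ∀ z, (f z).IsHermitian) {C : ℝ} (hC : ∀ z, ‖f z‖ ≤ C)
    {v : ℝ} (hv : 0 < v)
    (h : ∀ θ, 0 < θ →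
      ∫ z, traceRe (f z * NormedSpace.exp (θ • f z)) ∂μ ≤ θ * v * traceMgf μ f θ)
    {t : ℝ} (ht : 0 ≤ t) :
    μ.real {z | t ≤ lambdaMax (f z)} ≤ d * Real.exp (-t ^ 2 / (2 * v)) := by
  set θ := t / v with hθ
  have hθ0 : 0 ≤ θ := by positivity
  have hpos : ∀ z, 0 ≤ traceRe (NormedSpace.exp (θ • f z)) := fun z =>
    (Complex.nonneg_iff.1
      (posSemidef_exp (isHermitian_real_smul (hherm z) θ)).trace_nonneg).1
  obtain ⟨K, hK⟩ := exists_norm_exp_le (m := Fin d) (θ * C)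
  have hint : Integrable (fun z => traceRe (NormedSpace.exp (θ • f z))) μ := by
    have := integrable_traceRe_mul (μ := μ) (F := fun _ => 1) stronglyMeasurable_const
      (stronglyMeasurable_exp_smul hf θ) (fun _ => le_rfl) (K := K) (fun z => hK _ (by
        rw [norm_smul, Real.norm_of_nonneg hθ0]
        exact mul_le_mul_of_nonneg_left (hC z) hθ0))
    simpa using this
  have hmarkov := mul_meas_ge_le_integral_of_nonneg
    (Filter.Eventually.of_forall hpos) hint (Real.exp (θ * t))
  have hsub : μ.real {z | t ≤ lambdaMax (f z)} ≤
      μ.real {z | Real.exp (θ * t) ≤ traceRe (NormedSpace.exp (θ • f z))} :=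
    measureReal_mono fun z hz => exp_mul_le_traceRe_exp hd (hherm z) hθ0 hz
  have hmgf := traceMgf_le_of_deriv_le hf hC h hθ0
  have h1 : Real.exp (θ * t) * μ.real {z | t ≤ lambdaMax (f z)} ≤
      d * Real.exp (v * θ ^ 2 / 2) := by
    refine (mul_le_mul_of_nonneg_left hsub (Real.exp_pos _).le).trans (hmarkov.trans ?_)
    simpa [traceMgf] using hmgf
  have h2 := mul_le_mul_of_nonneg_left h1 (Real.exp_pos (-(θ * t))).le
  rw [← mul_assoc, ← Real.exp_add, neg_add_cancel, Real.exp_zero, one_mul] at h2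
  refine h2.trans (le_of_eq ?_)
  rw [mul_left_comm, ← Real.exp_add]
  congr 2
  rw [hθ]
  field_simp
  ring

end TraceMgf

/-! ### The differential inequality for the trace moment generating function -/

section Stein

variable {n d : ℕ} {Λ : Fin n → Type*} {A : Fin n → Matrix (Fin d) (Fin d) ℂ}

lemma oscLE_of_posSemidef {H : (∀ k, Λ k) → Matrix (Fin d) (Fin d) ℂ}
    (hH : ∀ z, (H z).IsHermitian)
    (hA : ∀ k, (A k).IsHermitian)
    (hdiff : ∀ (k : Fin n) (z : ∀ k, Λ k) (z' : Λ k),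
      ((A k) ^ 2 - (H z - H (Function.update z k z')) ^ 2).PosSemidef) :
    OscLE H fun k => ‖A k‖ := fun k z y =>
  norm_le_of_posSemidef (hA k) ((hH _).sub (hH _)) (hdiff k z y)

variable [∀ k, MeasurableSpace (Λ k)]
  {κ : ∀ i, Kernel (∀ j : {j : Fin n // j ≠ i}, Λ j) (Λ i)}
  {D : Matrix (Fin n) (Fin n) ℝ}
  {f : (∀ k, Λ k) → Matrix (Fin d) (Fin d) ℂ}

lemma integral_pairLaw_mono {μ : Measure (∀ k, Λ k)} (i : Fin n)
    {F F' : (∀ k, Λ k) × (∀ k, Λ k) → ℝ}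
    (hF : StronglyMeasurable F) (hF' : StronglyMeasurable F')
    (hi : Integrable F (pairLaw κ μ i)) (hi' : Integrable F' (pairLaw κ μ i))
    (h : ∀ z y, F (z, Function.update z i y) ≤ F' (z, Function.update z i y)) :
    ∫ p, F p ∂pairLaw κ μ i ≤ ∫ p, F' p ∂pairLaw κ μ i := by
  have hm := (measurable_prod_update (Λ := Λ) i)
  rw [pairLaw, integrable_map_measure hF.aestronglyMeasurable hm.aemeasurable] at hi
  rw [pairLaw, integrable_map_measure hF'.aestronglyMeasurable hm.aemeasurable] at hi'
  rw [pairLaw, integral_map hm.aemeasurable hF.aestronglyMeasurable,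
    integral_map hm.aemeasurable hF'.aestronglyMeasurable]
  exact integral_mono hi hi' fun p => h p.1 p.2

variable [∀ i, IsMarkovKernel (κ i)]

lemma isHermitian_poissonSum (hf : StronglyMeasurable f) {C : ℝ} (hC : ∀ z, ‖f z‖ ≤ C)
    (hherm : ∀ z, (f z).IsHermitian) (T : ℕ) (z : ∀ k, Λ k) :
    (poissonSum κ f T z).IsHermitian := by
  let ψ : Matrix (Fin d) (Fin d) ℂ →L[ℝ] Matrix (Fin d) (Fin d) ℂ :=
    LinearMap.toContinuousLinearMap
      { toFun := fun M => Mᴴ - M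
        map_add' := fun M N => by rw [Matrix.conjTranspose_add]; abel
        map_smul' := fun c M => by
          rw [Matrix.conjTranspose_smul, smul_sub]
          simp }
  have hψ : ∀ M, ψ M = Mᴴ - M := fun _ => rfl
  have h := congrFun (poissonSum_comp_continuousLinearMap (κ := κ) ψ hf hC T) z
  have h0 := norm_poissonSum_le (κ := κ) (f := fun z => ψ (f z)) (C := 0)
    (fun z => by rw [hψ, (hherm z).eq, sub_self, norm_zero]) T z
  rw [h, mul_zero, mul_zero, norm_le_zero_iff, hψ, sub_eq_zero] at h0
  exact h0

/-- The square of an increment of the approximate solution of the Poisson equation is dominated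
in the Loewner order; this is the vector-valued Dobrushin estimate applied to `z ↦ f z x` for each
vector `x`. -/
lemma posSemidef_poissonSum_increment (hD : ∀ i j, 0 ≤ D i j) (hTV : DobrushinLE κ D)
    (hD1 : normOne D < 1) (hf : StronglyMeasurable f) {C : ℝ} (hC : ∀ z, ‖f z‖ ≤ C)
    (hherm : ∀ z, (f z).IsHermitian) (hA : ∀ k, (A k).IsHermitian)
    (hdiff : ∀ (k : Fin n) (z : ∀ k, Λ k) (y : Λ k),
      ((A k) ^ 2 - (f z - f (Function.update z k y)) ^ 2).PosSemidef)
    (T : ℕ) (i : Fin n) (z : ∀ k, Λ k) (y : Λ i) :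
    ((∑ j, ((1 / (1 - normOne D) * neumannSum D T j i : ℝ) : ℂ) • A j ^ 2) -
      (poissonSum κ f T z - poissonSum κ f T (Function.update z i y)) ^ 2).PosSemidef := by
  refine posSemidef_sum_smul_sq_sub_sq hA
    ((isHermitian_poissonSum hf hC hherm T _).sub (isHermitian_poissonSum hf hC hherm T _))
    (fun j => neumannSum_nonneg hD T j i) ?_ fun x => ?_
  · have := sum_neumannSum_le (D := Dᵀ) (fun i j => hD j i) (normInf_nonneg _)
      (by rwa [normInf_transpose]) (sum_le_normInf _) T i
    rwa [normInf_transpose, ← neumannSum_transpose] at this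
  · have hosc : OscLE (fun z => evalCLM x (f z)) (fun k => ‖evalCLM x (A k)‖) := fun k z y => by
      rw [← map_sub]
      exact norm_evalCLM_le_of_posSemidef (hA k) ((hherm _).sub (hherm _)) (hdiff k z y) x
    have hm : StronglyMeasurable fun z => evalCLM x (f z) :=
      (evalCLM x).continuous.comp_stronglyMeasurable hf
    have hb : ∀ z, ‖evalCLM x (f z)‖ ≤ C * ‖x‖ := fun z =>
      (norm_evalCLM_le x _).trans (mul_le_mul_of_nonneg_right (hC z) (norm_nonneg x))
    have h := oscLE_poissonSum hD hTV hm (fun k => norm_nonneg _) hb hosc T i z y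
    rw [poissonSum_comp_continuousLinearMap (evalCLM x) hf hC, ← map_sub] at h
    refine h.trans (le_of_eq ?_)
    simp only [Matrix.vecMul, dotProduct]
    exact Finset.sum_congr rfl fun j _ => mul_comm _ _

/-- The Loewner bounds on the increments turn the mean value trace inequality into a bound by
traces against the fixed matrices `A j ^ 2`. -/
lemma traceRe_increment_le (hD : ∀ i j, 0 ≤ D i j) (hTV : DobrushinLE κ D)
    (hD1 : normOne D < 1) (hf : StronglyMeasurable f) {C : ℝ} (hC : ∀ z, ‖f z‖ ≤ C)
    (hherm : ∀ z, (f z).IsHermitian) (hA : ∀ k, (A k).IsHermitian)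
    (hdiff : ∀ (k : Fin n) (z : ∀ k, Λ k) (y : Λ k),
      ((A k) ^ 2 - (f z - f (Function.update z k y)) ^ 2).PosSemidef)
    (T : ℕ) {θ s : ℝ} (hθ : 0 < θ) (hs : 0 < s) (i : Fin n) (z : ∀ k, Λ k) (y : Λ i) :
    traceRe ((poissonSum κ f T z - poissonSum κ f T (Function.update z i y)) *
        (NormedSpace.exp (θ • f z) - NormedSpace.exp (θ • f (Function.update z i y)))) ≤
      θ / 4 * traceRe
        ((NormedSpace.exp (θ • f z) + NormedSpace.exp (θ • f (Function.update z i y))) *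
        (s • A i ^ 2 + s⁻¹ • ∑ j, (1 / (1 - normOne D) * neumannSum D T j i) • A j ^ 2)) := by
  set z' := Function.update z i y
  set N := poissonSum κ f T z - poissonSum κ f T z'
  set G := NormedSpace.exp (θ • f z) + NormedSpace.exp (θ • f z')
  have hN : N.IsHermitian :=
    (isHermitian_poissonSum hf hC hherm T _).sub (isHermitian_poissonSum hf hC hherm T _)
  have hG : G.PosSemidef := (posSemidef_exp (isHermitian_real_smul (hherm z) θ)).add
    (posSemidef_exp (isHermitian_real_smul (hherm z') θ))
  have h1 := trace_exp_sub_exp_mul_le (isHermitian_real_smul (hherm z) θ)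
    (isHermitian_real_smul (hherm z') θ) hN (div_pos hs hθ)
  have h2 := trace_mul_re_mono hG (hdiff i z y)
  have h3 := trace_mul_re_mono hG
    (posSemidef_poissonSum_increment hD hTV hD1 hf hC hherm hA hdiff T i z y)
  have e : ((s / θ : ℝ) : ℂ) • (θ • f z - θ • f z') ^ 2 + (((s / θ)⁻¹ : ℝ) : ℂ) • N ^ 2 =
      θ • (s • (f z - f z') ^ 2 + s⁻¹ • N ^ 2) := by
    rw [Complex.coe_smul, Complex.coe_smul, ← smul_sub, smul_pow, smul_smul, smul_add, smul_smul,
      smul_smul]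
    congr 2
    · field_simp
    · rw [inv_div, div_eq_mul_inv]
  rw [e] at h1
  simp only [← traceRe_apply] at h1 h2 h3
  simp only [Complex.coe_smul] at h3
  rw [traceRe_mul_comm]
  refine h1.trans ?_
  rw [Matrix.mul_smul, map_smul, smul_eq_mul, Matrix.mul_add, Matrix.mul_add, map_add, map_add,
    Matrix.mul_smul, Matrix.mul_smul, Matrix.mul_smul, Matrix.mul_smul, map_smul, map_smul,
    map_smul, map_smul]
  simp only [smul_eq_mul]
  have h2' := mul_le_mul_of_nonneg_left h2 hs.le
  have h3' := mul_le_mul_of_nonneg_left h3 (inv_pos.2 hs).le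
  have := mul_le_mul_of_nonneg_left (add_le_add h2' h3') hθ.le
  linarith

variable {μ : Measure (∀ k, Λ k)} [IsProbabilityMeasure μ]

lemma integral_pairLaw_fst (i : Fin n) {F : (∀ k, Λ k) → ℝ} (hF : StronglyMeasurable F)
    {C : ℝ} (hC : ∀ z, ‖F z‖ ≤ C) : ∫ p, F p.1 ∂pairLaw κ μ i = ∫ z, F z ∂μ := by
  rw [integral_pairLaw i (F := fun p => F p.1) (hF.comp_measurable measurable_fst)
    (fun p => hC p.1)]
  simp

/-- Integration by parts for the exchangeable pair `pairLaw κ μ i`. -/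
lemma integral_traceRe_sub_resample_mul (i : Fin n)
    (hμ : μ.map (fun z => (dropCoord i z, z i)) = μ.map (dropCoord i) ⊗ₘ κ i)
    {h G : (∀ k, Λ k) → Matrix (Fin d) (Fin d) ℂ}
    (hh : StronglyMeasurable h) (hG : StronglyMeasurable G) {C K : ℝ}
    (hC : ∀ z, ‖h z‖ ≤ C) (hK : ∀ z, ‖G z‖ ≤ K) :
    ∫ z, traceRe ((h z - resample κ i h z) * G z) ∂μ =
      1 / 2 * ∫ p, traceRe ((h p.1 - h p.2) * (G p.1 - G p.2)) ∂pairLaw κ μ i := by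
  have h1 : StronglyMeasurable fun p : (∀ k, Λ k) × (∀ k, Λ k) => h p.1 - h p.2 :=
    (hh.comp_measurable measurable_fst).sub (hh.comp_measurable measurable_snd)
  have b1 : ∀ p : (∀ k, Λ k) × (∀ k, Λ k), ‖h p.1 - h p.2‖ ≤ C + C := fun p =>
    (norm_sub_le _ _).trans (add_le_add (hC _) (hC _))
  have g1 : StronglyMeasurable fun p : (∀ k, Λ k) × (∀ k, Λ k) => G p.1 :=
    hG.comp_measurable measurable_fst
  have g2 : StronglyMeasurable fun p : (∀ k, Λ k) × (∀ k, Λ k) => G p.2 :=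
    hG.comp_measurable measurable_snd
  have m1 : StronglyMeasurable fun p : (∀ k, Λ k) × (∀ k, Λ k) =>
      traceRe ((h p.1 - h p.2) * G p.1) :=
    traceRe.continuous.comp_stronglyMeasurable (h1.mul g1)
  have i1 := integrable_traceRe_mul (μ := pairLaw κ μ i) h1 g1 b1 (fun p => hK p.1)
  have i2 := integrable_traceRe_mul (μ := pairLaw κ μ i) h1 g2 b1 (fun p => hK p.2)
  have hsplit : ∫ z, traceRe ((h z - resample κ i h z) * G z) ∂μ =
      ∫ p, traceRe ((h p.1 - h p.2) * G p.1) ∂pairLaw κ μ i := by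
    rw [integral_pairLaw i m1
      (C := ‖(traceRe : Matrix (Fin d) (Fin d) ℂ →L[ℝ] ℝ)‖ * ((C + C) * K)) fun p => by
        have := (norm_nonneg _).trans (b1 p)
        refine (abs_traceRe_mul_le _ _).trans ?_
        gcongr
        exacts [b1 p, hK p.1]]
    refine integral_congr_ae (Filter.Eventually.of_forall fun z => ?_)
    let φ : Matrix (Fin d) (Fin d) ℂ →L[ℝ] ℝ :=
      LinearMap.toContinuousLinearMap
        ((traceRe : Matrix (Fin d) (Fin d) ℂ →L[ℝ] ℝ).toLinearMap ∘ₗ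
          LinearMap.mulRight ℝ (G z))
    have hφ : ∀ M, φ M = traceRe (M * G z) := fun _ => rfl
    have hint := integrable_comp_update hh hC i z (κ i (dropCoord i z))
    simp only [← hφ]
    have hcomm : ∫ y, φ (h z - h (Function.update z i y)) ∂κ i (dropCoord i z) =
        φ (∫ y, (h z - h (Function.update z i y)) ∂κ i (dropCoord i z)) :=
      φ.integral_comp_comm ((integrable_const _).sub hint)
    rw [hcomm, integral_sub (integrable_const _) hint]
    simp [resample]
  have hswap : ∫ p, traceRe ((h p.1 - h p.2) * G p.1) ∂pairLaw κ μ i =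
      -∫ p, traceRe ((h p.1 - h p.2) * G p.2) ∂pairLaw κ μ i := by
    rw [← integral_pairLaw_swap i hμ m1, ← integral_neg]
    refine integral_congr_ae (Filter.Eventually.of_forall fun p => ?_)
    simp only [Prod.fst_swap, Prod.snd_swap]
    rw [← map_neg, ← Matrix.neg_mul, neg_sub]
  have hdiff : ∫ p, traceRe ((h p.1 - h p.2) * (G p.1 - G p.2)) ∂pairLaw κ μ i =
      ∫ p, traceRe ((h p.1 - h p.2) * G p.1) ∂pairLaw κ μ i -
      ∫ p, traceRe ((h p.1 - h p.2) * G p.2) ∂pairLaw κ μ i := by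
    rw [← integral_sub i1 i2]
    simp only [Matrix.mul_sub, map_sub]
  rw [hsplit, hdiff]
  linarith

/-- The two copies in an exchangeable pair contribute equally. -/
lemma integral_pairLaw_traceRe_add_mul (i : Fin n)
    (hμ : μ.map (fun z => (dropCoord i z, z i)) = μ.map (dropCoord i) ⊗ₘ κ i)
    {G : (∀ k, Λ k) → Matrix (Fin d) (Fin d) ℂ} (hG : StronglyMeasurable G) {K : ℝ}
    (hK : ∀ z, ‖G z‖ ≤ K) (R : Matrix (Fin d) (Fin d) ℂ) :
    ∫ p, traceRe ((G p.1 + G p.2) * R) ∂pairLaw κ μ i = 2 * ∫ z, traceRe (G z * R) ∂μ := by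
  have g1 : StronglyMeasurable fun p : (∀ k, Λ k) × (∀ k, Λ k) => G p.1 :=
    hG.comp_measurable measurable_fst
  have g2 : StronglyMeasurable fun p : (∀ k, Λ k) × (∀ k, Λ k) => G p.2 :=
    hG.comp_measurable measurable_snd
  have i1 := integrable_traceRe_mul (μ := pairLaw κ μ i) g1
    (G := fun _ => R) stronglyMeasurable_const (fun p => hK p.1) (fun _ => le_rfl)
  have i2 := integrable_traceRe_mul (μ := pairLaw κ μ i) g2
    (G := fun _ => R) stronglyMeasurable_const (fun p => hK p.2) (fun _ => le_rfl)
  have m : StronglyMeasurable fun z => traceRe (G z * R) :=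
    traceRe.continuous.comp_stronglyMeasurable (hG.mul stronglyMeasurable_const)
  have m1 : StronglyMeasurable fun p : (∀ k, Λ k) × (∀ k, Λ k) => traceRe (G p.1 * R) :=
    m.comp_measurable measurable_fst
  have hfst := integral_pairLaw_fst (κ := κ) (μ := μ) i m
    (C := ‖(traceRe : Matrix (Fin d) (Fin d) ℂ →L[ℝ] ℝ)‖ * (K * ‖R‖)) fun z => by
      refine (abs_traceRe_mul_le _ _).trans ?_
      gcongr
      exact hK z
  have hsnd := integral_pairLaw_swap (κ := κ) i hμ m1
  simp only [Prod.fst_swap] at hsnd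
  simp only [Matrix.add_mul, map_add]
  rw [integral_add i1 i2, hsnd, hfst]
  ring

/-- The differential inequality, up to the error made by truncating the Neumann series. -/
lemma integral_traceRe_mul_exp_le_add (hn : n ≠ 0)
    (hμ : ∀ i, μ.map (fun z => (dropCoord i z, z i)) = μ.map (dropCoord i) ⊗ₘ κ i)
    (hD : ∀ i j, 0 ≤ D i j) (hTV : DobrushinLE κ D)
    (hD1 : normOne D < 1) (hDinf : normInf D < 1)
    (hf : StronglyMeasurable f) {C : ℝ} (hC : ∀ z, ‖f z‖ ≤ C)
    (hherm : ∀ z, (f z).IsHermitian) (hA : ∀ k, (A k).IsHermitian)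
    (hdiff : ∀ (k : Fin n) (z : ∀ k, Λ k) (y : Λ k),
      ((A k) ^ 2 - (f z - f (Function.update z k y)) ^ 2).PosSemidef)
    {θ : ℝ} (hθ : 0 < θ) (T : ℕ) :
    ∫ z, traceRe (f z * NormedSpace.exp (θ • f z)) ∂μ ≤
      θ * ((1 / (1 - normOne D) + 1 / (1 - normInf D)) / 2 * ‖∑ k, A k ^ 2‖ / 2) *
        traceMgf μ f θ +
      ∫ z, traceRe (((gibbsStep κ)^[T] f) z * NormedSpace.exp (θ • f z)) ∂μ := by
  set a := 1 - normOne D with ha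
  set b := 1 - normInf D with hb
  have ha0 : 0 < a := by linarith
  have hb0 : 0 < b := by linarith
  set G : (∀ k, Λ k) → Matrix (Fin d) (Fin d) ℂ := fun z => NormedSpace.exp (θ • f z) with hGdef
  set h := poissonSum κ f T with hh
  set W := neumannSum D T with hW
  -- with the weight `s = 1 / a` the increments of `f` and of `h` contribute `1 / a` and `1 / b`
  set R : Fin n → Matrix (Fin d) (Fin d) ℂ := fun i =>
    a⁻¹ • A i ^ 2 + (a⁻¹)⁻¹ • ∑ j, (1 / a * W j i) • A j ^ 2 with hR
  obtain ⟨K, hK'⟩ := exists_norm_exp_le (m := Fin d) (θ * C)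
  have hK : ∀ z, ‖G z‖ ≤ K := fun z => hK' _ (by
    rw [norm_smul, Real.norm_of_nonneg hθ.le]
    exact mul_le_mul_of_nonneg_left (hC z) hθ.le)
  have hG : StronglyMeasurable G := stronglyMeasurable_exp_smul hf θ
  have hGpos : ∀ z, (G z).PosSemidef := fun z =>
    posSemidef_exp (isHermitian_real_smul (hherm z) θ)
  have hhm : StronglyMeasurable h := stronglyMeasurable_poissonSum hf T
  have hhC : ∀ z, ‖h z‖ ≤ (n : ℝ)⁻¹ * (T * C) := norm_poissonSum_le hC T
  have hint : ∀ R, Integrable (fun z => traceRe (G z * R)) μ := fun R =>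
    integrable_traceRe_mul hG (G := fun _ => R) stronglyMeasurable_const hK (fun _ => le_rfl)
  have hterm : ∀ i, ∫ z, traceRe ((h z - resample κ i h z) * G z) ∂μ ≤
      θ / 4 * ∫ z, traceRe (G z * R i) ∂μ := by
    intro i
    rw [integral_traceRe_sub_resample_mul i (hμ i) hhm hG hhC hK]
    have h1 : StronglyMeasurable fun p : (∀ k, Λ k) × (∀ k, Λ k) => h p.1 - h p.2 :=
      (hhm.comp_measurable measurable_fst).sub (hhm.comp_measurable measurable_snd)
    have g1 : StronglyMeasurable fun p : (∀ k, Λ k) × (∀ k, Λ k) => G p.1 - G p.2 :=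
      (hG.comp_measurable measurable_fst).sub (hG.comp_measurable measurable_snd)
    have g2 : StronglyMeasurable fun p : (∀ k, Λ k) × (∀ k, Λ k) => G p.1 + G p.2 :=
      (hG.comp_measurable measurable_fst).add (hG.comp_measurable measurable_snd)
    have hmono := integral_pairLaw_mono (κ := κ) (μ := μ) i
      (F := fun p => traceRe ((h p.1 - h p.2) * (G p.1 - G p.2)))
      (F' := fun p => θ / 4 * traceRe ((G p.1 + G p.2) * R i))
      (traceRe.continuous.comp_stronglyMeasurable (h1.mul g1))
      ((traceRe.continuous.comp_stronglyMeasurable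
        (g2.mul stronglyMeasurable_const)).const_mul _)
      (integrable_traceRe_mul h1 g1
        (fun p => (norm_sub_le _ _).trans (add_le_add (hhC _) (hhC _)))
        (fun p => (norm_sub_le _ _).trans (add_le_add (hK _) (hK _))))
      ((integrable_traceRe_mul g2 (G := fun _ => R i) stronglyMeasurable_const
        (fun p => (norm_add_le _ _).trans (add_le_add (hK _) (hK _)))
        (fun _ => le_rfl)).const_mul _)
      (fun z y => traceRe_increment_le hD hTV hD1 hf hC hherm hA hdiff T hθ (inv_pos.2 ha0) i z y)
    rw [integral_const_mul, integral_pairLaw_traceRe_add_mul i (hμ i) hG hK] at hmono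
    linarith
  have hsum : ∫ z, traceRe (f z * G z) ∂μ =
      ∑ i, ∫ z, traceRe ((h z - resample κ i h z) * G z) ∂μ +
        ∫ z, traceRe (((gibbsStep κ)^[T] f) z * G z) ∂μ := by
    have hi : ∀ i, Integrable (fun z => traceRe ((h z - resample κ i h z) * G z)) μ := fun i =>
      integrable_traceRe_mul (hhm.sub (stronglyMeasurable_resample i hhm)) hG
        (fun z => (norm_sub_le _ _).trans (add_le_add (hhC _) (norm_resample_le hhC i z))) hK
    rw [← integral_finsetSum _ fun i _ => hi i,
      ← integral_add (integrable_finsetSum _ fun i _ => hi i)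
      (integrable_traceRe_mul (stronglyMeasurable_gibbsStep_iterate hf T) hG
        (norm_gibbsStep_iterate_le hC T) hK)]
    refine integral_congr_ae (Filter.Eventually.of_forall fun z => ?_)
    simp only
    rw [← map_sum, ← Finset.sum_mul, sum_poissonSum_sub_resample hn hf hC T z, ← map_add,
      ← add_mul, sub_add_cancel]
  have hRsum : ∀ z, ∑ i, traceRe (G z * R i) ≤
      (1 / a + 1 / b) * ‖∑ k, A k ^ 2‖ * traceRe (G z) := by
    intro z
    set g : Fin n → ℝ := fun j => traceRe (G z * A j ^ 2) with hg
    have hg0 : ∀ j, 0 ≤ g j := fun j => by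
      have hp : (A j ^ 2).PosSemidef := by
        have := Matrix.posSemidef_conjTranspose_mul_self (A j)
        rwa [(hA j).eq, ← pow_two] at this
      exact trace_mul_re_nonneg (hGpos z) hp
    have e1 : ∀ i, traceRe (G z * R i) = a⁻¹ * g i + ∑ j, W j i * g j := by
      intro i
      simp only [hR, inv_inv]
      rw [Matrix.mul_add, map_add, Matrix.mul_smul, map_smul, Matrix.mul_smul, map_smul,
        Matrix.mul_sum, map_sum]
      simp only [Matrix.mul_smul, map_smul, smul_eq_mul]
      rw [Finset.mul_sum]
      congr 1
      refine Finset.sum_congr rfl fun j _ => ?_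
      simp only [hg]
      field_simp
    have e2 : ∑ i, ∑ j, W j i * g j ≤ 1 / b * ∑ j, g j := by
      rw [Finset.sum_comm, Finset.mul_sum]
      refine Finset.sum_le_sum fun j _ => ?_
      rw [← Finset.sum_mul]
      exact mul_le_mul_of_nonneg_right
        (sum_neumannSum_le hD (normInf_nonneg D) hDinf (sum_le_normInf D) T j) (hg0 j)
    have e3 : ∑ j, g j ≤ ‖∑ k, A k ^ 2‖ * traceRe (G z) := by
      have hs : (∑ k, A k ^ 2).IsHermitian := by
        rw [Matrix.IsHermitian, Matrix.conjTranspose_sum]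
        exact Finset.sum_congr rfl fun k _ => ((hA k).pow 2).eq
      have := traceRe_mul_le_norm (hGpos z) hs
      rwa [Matrix.mul_sum, map_sum] at this
    calc ∑ i, traceRe (G z * R i) = 1 / a * ∑ j, g j + ∑ i, ∑ j, W j i * g j := by
          simp only [e1, Finset.sum_add_distrib, ← Finset.mul_sum, one_div]
      _ ≤ (1 / a + 1 / b) * ∑ j, g j := by linarith
      _ ≤ (1 / a + 1 / b) * (‖∑ k, A k ^ 2‖ * traceRe (G z)) :=
          mul_le_mul_of_nonneg_left e3 (by positivity)
      _ = _ := by ring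
  have hintG : Integrable (fun z => traceRe (G z)) μ := by simpa using hint 1
  have hfinal : ∑ i, ∫ z, traceRe (G z * R i) ∂μ ≤
      (1 / a + 1 / b) * ‖∑ k, A k ^ 2‖ * traceMgf μ f θ := by
    rw [← integral_finsetSum _ fun i _ => hint _, traceMgf, ← integral_const_mul]
    exact integral_mono (integrable_finsetSum _ fun i _ => hint _) (hintG.const_mul _) hRsum
  rw [hsum]
  gcongr
  calc _ ≤ ∑ i, θ / 4 * ∫ z, traceRe (G z * R i) ∂μ := Finset.sum_le_sum fun i _ => hterm i
    _ = θ / 4 * ∑ i, ∫ z, traceRe (G z * R i) ∂μ := by rw [Finset.mul_sum]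
    _ ≤ θ / 4 * ((1 / a + 1 / b) * ‖∑ k, A k ^ 2‖ * traceMgf μ f θ) := by gcongr
    _ = _ := by ring

/-- The differential inequality `m'(θ) ≤ θ (c σ² / 2) m(θ)` for the trace moment generating function
`m` of a centred `f`; the truncation error vanishes in the limit `T → ∞`. -/
lemma integral_traceRe_mul_exp_le (hn : n ≠ 0)
    (hμ : ∀ i, μ.map (fun z => (dropCoord i z, z i)) = μ.map (dropCoord i) ⊗ₘ κ i)
    (hD : ∀ i j, 0 ≤ D i j) (hTV : DobrushinLE κ D)
    (hD1 : normOne D < 1) (hDinf : normInf D < 1)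
    (hf : StronglyMeasurable f) {C : ℝ} (hC : ∀ z, ‖f z‖ ≤ C)
    (hherm : ∀ z, (f z).IsHermitian) (hA : ∀ k, (A k).IsHermitian)
    (hdiff : ∀ (k : Fin n) (z : ∀ k, Λ k) (y : Λ k),
      ((A k) ^ 2 - (f z - f (Function.update z k y)) ^ 2).PosSemidef)
    (h0 : ∫ z, f z ∂μ = 0) {θ : ℝ} (hθ : 0 < θ) :
    ∫ z, traceRe (f z * NormedSpace.exp (θ • f z)) ∂μ ≤
      θ * ((1 / (1 - normOne D) + 1 / (1 - normInf D)) / 2 * ‖∑ k, A k ^ 2‖ / 2) *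
        traceMgf μ f θ := by
  obtain ⟨z₀⟩ := nonempty_of_isProbabilityMeasure μ
  obtain ⟨K, hK'⟩ := exists_norm_exp_le (m := Fin d) (θ * C)
  have hK : ∀ z, ‖NormedSpace.exp (θ • f z)‖ ≤ K := fun z => hK' _ (by
    rw [norm_smul, Real.norm_of_nonneg hθ.le]
    exact mul_le_mul_of_nonneg_left (hC z) hθ.le)
  have hK0 : 0 ≤ K := (norm_nonneg _).trans (hK z₀)
  set ρ := 1 - (1 - normInf D) / n with hρ
  have hn1 : (1 : ℝ) ≤ n := by exact_mod_cast Nat.one_le_iff_ne_zero.2 hn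
  have hρ0 : 0 ≤ ρ := by
    have : (1 - normInf D) / n ≤ 1 := by
      rw [div_le_one (by linarith)]
      linarith [normInf_nonneg D]
    linarith
  have hρ1 : ρ < 1 := by
    have : 0 < (1 - normInf D) / n := div_pos (by linarith) (by linarith)
    linarith
  have hosc := oscLE_of_posSemidef hherm hA hdiff
  set τ := ‖(traceRe : Matrix (Fin d) (Fin d) ℂ →L[ℝ] ℝ)‖
  have herr : ∀ T, ∫ z, traceRe (((gibbsStep κ)^[T] f) z * NormedSpace.exp (θ • f z)) ∂μ ≤
      τ * (ρ ^ T * (∑ k, ‖A k‖) * K) := by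
    intro T
    have := norm_integral_le_of_norm_le_const (μ := μ)
      (f := fun z => traceRe (((gibbsStep κ)^[T] f) z * NormedSpace.exp (θ • f z)))
      (C := τ * (ρ ^ T * (∑ k, ‖A k‖) * K)) (Filter.Eventually.of_forall fun z => by
        refine (abs_traceRe_mul_le _ _).trans ?_
        gcongr
        · exact norm_gibbsStep_iterate_le_of_integral_eq_zero hμ hD hTV hf
            (fun k => norm_nonneg _) hC hosc h0 T z
        · exact hK z)
    rw [probReal_univ, mul_one] at this
    exact (le_abs_self _).trans this
  have hlim : Filter.Tendsto (fun T : ℕ =>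
      θ * ((1 / (1 - normOne D) + 1 / (1 - normInf D)) / 2 * ‖∑ k, A k ^ 2‖ / 2) *
        traceMgf μ f θ + τ * (ρ ^ T * (∑ k, ‖A k‖) * K)) Filter.atTop
      (nhds (θ * ((1 / (1 - normOne D) + 1 / (1 - normInf D)) / 2 * ‖∑ k, A k ^ 2‖ / 2) *
        traceMgf μ f θ + τ * (0 * (∑ k, ‖A k‖) * K))) :=
    ((((tendsto_pow_atTop_nhds_zero_of_lt_one hρ0 hρ1).mul_const _).mul_const _).const_mul
      _).const_add _
  have := ge_of_tendsto' hlim fun T =>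
    (integral_traceRe_mul_exp_le_add hn hμ hD hTV hD1 hDinf hf hC hherm hA hdiff hθ T).trans
      (add_le_add le_rfl (herr T))
  simpa using this

end Stein

/-! ### Conditional laws and the concentration bound -/

section Application

variable {n d : ℕ}

lemma specNorm_eq_norm (M : Matrix (Fin d) (Fin d) ℂ) : specNorm M = ‖M‖ :=
  Matrix.l2_opNorm_toEuclideanCLM M

lemma stronglyMeasurable_matrix {E : Type*} [MeasurableSpace E]
    {H : E → Matrix (Fin d) (Fin d) ℂ} (hH : ∀ i j, Measurable fun z => H z i j) :
    StronglyMeasurable H := by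
  have e : H = fun z => ∑ i, ∑ j, H z i j • Matrix.single i j (1 : ℂ) := by
    funext z
    conv_lhs => rw [Matrix.matrix_eq_sum_single (H z)]
    simp [Matrix.smul_single]
  rw [e]
  exact Finset.stronglyMeasurable_fun_sum _ fun i _ => Finset.stronglyMeasurable_fun_sum _
    fun j _ => (hH i j).stronglyMeasurable.smul_const _

/-- The entry `M i j` as a continuous real-linear functional. -/
noncomputable def entryCLM (i j : Fin d) : Matrix (Fin d) (Fin d) ℂ →L[ℝ] ℂ :=
  LinearMap.toContinuousLinearMap (Matrix.entryLinearMap ℝ ℂ i j)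

lemma matrixExpectation_eq_integral {Ω : Type*} [MeasurableSpace Ω] {P : Measure Ω}
    {X : Ω → Matrix (Fin d) (Fin d) ℂ} (hX : Integrable X P) :
    matrixExpectation P X = ∫ ω, X ω ∂P := by
  ext i j
  exact (entryCLM i j).integral_comp_comm hX

lemma isHermitian_matrixExpectation {Ω : Type*} [MeasurableSpace Ω] {P : Measure Ω}
    {X : Ω → Matrix (Fin d) (Fin d) ℂ} (hX : ∀ ω, (X ω).IsHermitian) :
    (matrixExpectation P X).IsHermitian := by
  ext i j
  simp only [matrixExpectation, Matrix.conjTranspose_apply, Matrix.of_apply]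
  rw [← starRingEnd_apply, ← integral_conj]
  exact integral_congr_ae (Filter.Eventually.of_forall fun ω => (hX ω).apply i j)

lemma lambdaMax_zero (hd : 1 ≤ d) : lambdaMax (0 : Matrix (Fin d) (Fin d) ℂ) = 0 := by
  have : Nonempty (Fin d) := ⟨⟨0, hd⟩⟩
  simp [lambdaMax, spectrum.zero_eq]

lemma eq_zero_of_sum_sq_eq_zero {A : Fin n → Matrix (Fin d) (Fin d) ℂ}
    (hA : ∀ k, (A k).IsHermitian) (h : ∑ k, A k ^ 2 = 0) (k : Fin n) : A k = 0 := by
  have e : ∀ k, A k ^ 2 = (A k)ᴴ * A k := fun k => by rw [(hA k).eq, pow_two]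
  have h0 : ∑ k, (A k ^ 2).trace = 0 := by rw [← Matrix.trace_sum, h, Matrix.trace_zero]
  rw [Finset.sum_eq_zero_iff_of_nonneg fun k _ => by
    rw [e]; exact (Matrix.posSemidef_conjTranspose_mul_self _).trace_nonneg] at h0
  have := h0 k (Finset.mem_univ k)
  rwa [e, Matrix.trace_conjTranspose_mul_self_eq_zero_iff] at this

variable {Λ : Fin n → Type*} [∀ k, MeasurableSpace (Λ k)]
  {Ω : Type*} [MeasurableSpace Ω] {P : Measure Ω} {Z : ∀ k, Ω → Λ k}

lemma map_eq_compProd_of_hasCondDistrib (hZ : ∀ k, Measurable (Z k)) (i : Fin n)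
    {κ : Kernel (∀ j : {j : Fin n // j ≠ i}, Λ j) (Λ i)}
    (h : HasCondDistrib (fun ω => Z i ω) (fun ω => dropCoord i fun k => Z k ω) κ P) :
    (P.map fun ω k => Z k ω).map (fun z => (dropCoord i z, z i)) =
      (P.map fun ω k => Z k ω).map (dropCoord i) ⊗ₘ κ := by
  have hm : Measurable fun ω k => Z k ω := measurable_pi_lambda _ hZ
  rw [Measure.map_map ((measurable_dropCoord i).prodMk (measurable_pi_apply i)) hm,
    Measure.map_map (measurable_dropCoord i) hm]
  exact h.map_eq

lemma hasCondDistrib_const_of_iIndepFun [IsProbabilityMeasure P] (hZ : ∀ k, Measurable (Z k))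
    (hind : iIndepFun Z P) (i : Fin n) :
    HasCondDistrib (fun ω => Z i ω) (fun ω => dropCoord i fun k => Z k ω)
      (Kernel.const _ (P.map (Z i))) P := by
  have : IsProbabilityMeasure (P.map (Z i)) :=
    Measure.isProbabilityMeasure_map (hZ i).aemeasurable
  have hdrop : Measurable fun ω => dropCoord i fun k => Z k ω :=
    (measurable_dropCoord i).comp (measurable_pi_lambda _ hZ)
  have h := hind.indepFun_finset (Finset.univ.erase i) {i} (by simp) hZ
  have hφ : Measurable fun (w : ∀ k : (Finset.univ.erase i : Finset (Fin n)), Λ k)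
      (j : {j : Fin n // j ≠ i}) => w ⟨j, Finset.mem_erase.2 ⟨j.2, Finset.mem_univ _⟩⟩ :=
    measurable_pi_lambda _ fun j => measurable_pi_apply _
  have hψ : Measurable fun w : (∀ k : ({i} : Finset (Fin n)), Λ k) =>
      w ⟨i, Finset.mem_singleton_self i⟩ := measurable_pi_apply _
  have h' : IndepFun (fun ω => dropCoord i fun k => Z k ω) (Z i) P := h.comp hφ hψ
  refine ⟨(hdrop.prodMk (hZ i)).aemeasurable, ?_⟩
  rw [Measure.compProd_const]
  exact (indepFun_iff_map_prod_eq_prod_map_map hdrop.aemeasurable (hZ i).aemeasurable).1 h'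

lemma dTV_self {α : Type*} [MeasurableSpace α] (μ : Measure α) : dTV μ μ = 0 := by
  simp [dTV]

variable {H : (∀ k, Λ k) → Matrix (Fin d) (Fin d) ℂ} {A : Fin n → Matrix (Fin d) (Fin d) ℂ}

/-- Concentration under the Dobrushin condition, for a family of conditional laws of the
coordinates. -/
lemma measureReal_lambdaMax_le_of_dobrushin [IsProbabilityMeasure P] (hd : 1 ≤ d)
    (hZ : ∀ k, Measurable (Z k)) (hH : ∀ z, (H z).IsHermitian)
    (hHmeas : ∀ i j, Measurable fun z => H z i j) (hA : ∀ k, (A k).IsHermitian)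
    (hdiff : ∀ (k : Fin n) (z : ∀ k, Λ k) (z' : Λ k),
      ((A k) ^ 2 - (H z - H (Function.update z k z')) ^ 2).PosSemidef)
    {κ : ∀ i, Kernel (∀ j : {j : Fin n // j ≠ i}, Λ j) (Λ i)} [∀ i, IsMarkovKernel (κ i)]
    (hκ : ∀ i, HasCondDistrib (fun ω => Z i ω) (fun ω => dropCoord i fun k => Z k ω) (κ i) P)
    {D : Matrix (Fin n) (Fin n) ℝ} (hD : ∀ i j, 0 ≤ D i j) (hTV : DobrushinLE κ D)
    (hD1 : normOne D < 1) (hDinf : normInf D < 1) {t : ℝ} (ht : 0 ≤ t) :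
    P.real {ω | t ≤ lambdaMax (H (fun k => Z k ω) -
        matrixExpectation P fun ω => H fun k => Z k ω)} ≤
      d * Real.exp (-t ^ 2 / ((1 / (1 - normOne D) + 1 / (1 - normInf D)) / 2 *
        specNorm (∑ k, A k ^ 2))) := by
  rw [specNorm_eq_norm]
  rcases (norm_nonneg (∑ k, A k ^ 2)).eq_or_lt with hσ | hσ
  · -- the exponent is `-t ^ 2 / 0 = 0`, so the bound is at least `1`
    rw [← hσ, mul_zero, div_zero, Real.exp_zero, mul_one]
    exact measureReal_le_one.trans (by exact_mod_cast hd)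
  have hn : n ≠ 0 := by
    rintro rfl
    simp at hσ
  set S : Ω → ∀ k, Λ k := fun ω k => Z k ω with hS
  have hSm : Measurable S := measurable_pi_lambda _ hZ
  set M := matrixExpectation P fun ω => H (S ω) with hM
  set μ := P.map S with hμdef
  have : IsProbabilityMeasure μ := Measure.isProbabilityMeasure_map hSm.aemeasurable
  have hHs : StronglyMeasurable H := stronglyMeasurable_matrix hHmeas
  obtain ⟨C, hC⟩ := (oscLE_of_posSemidef hH hA hdiff).exists_norm_le
  have hint : Integrable H μ :=
    Integrable.of_bound hHs.aestronglyMeasurable C (Filter.Eventually.of_forall hC)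
  set f : (∀ k, Λ k) → Matrix (Fin d) (Fin d) ℂ := fun z => H z - M with hf
  have hfs : StronglyMeasurable f := hHs.sub stronglyMeasurable_const
  have hfC : ∀ z, ‖f z‖ ≤ C + ‖M‖ := fun z =>
    (norm_sub_le _ _).trans (add_le_add (hC z) le_rfl)
  have hfh : ∀ z, (f z).IsHermitian := fun z =>
    (hH z).sub (isHermitian_matrixExpectation fun _ => hH _)
  have hfd : ∀ (k : Fin n) (z : ∀ k, Λ k) (y : Λ k),
      ((A k) ^ 2 - (f z - f (Function.update z k y)) ^ 2).PosSemidef := fun k z y => by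
    simpa only [hf, sub_sub_sub_cancel_right] using hdiff k z y
  have hMint : M = ∫ z, H z ∂μ := by
    have hHS : Integrable (fun ω => H (S ω)) P :=
      (integrable_map_measure hHs.aestronglyMeasurable hSm.aemeasurable).1 hint
    rw [hM, matrixExpectation_eq_integral hHS, hμdef,
      integral_map hSm.aemeasurable hHs.aestronglyMeasurable]
  have hf0 : ∫ z, f z ∂μ = 0 := by
    simp only [hf]
    rw [integral_sub hint (integrable_const _), integral_const, probReal_univ, one_smul, ← hMint,
      sub_self]
  have hμ : ∀ i, μ.map (fun z => (dropCoord i z, z i)) = μ.map (dropCoord i) ⊗ₘ κ i := fun i =>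
    map_eq_compProd_of_hasCondDistrib hZ i (hκ i)
  have hc : 0 < (1 / (1 - normOne D) + 1 / (1 - normInf D)) / 2 := by
    have h1 : 0 < 1 - normOne D := by linarith
    have h2 : 0 < 1 - normInf D := by linarith
    positivity
  -- the event need not be known to be measurable, and the inequality holds without that
  have hpush : P.real {ω | t ≤ lambdaMax (H (S ω) - M)} ≤ μ.real {z | t ≤ lambdaMax (f z)} :=
    ENNReal.toReal_mono (measure_ne_top _ _) (Measure.le_map_apply hSm.aemeasurable _)
  refine hpush.trans ((measureReal_lambdaMax_le hd hfs hfh hfC (half_pos (mul_pos hc hσ))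
    (fun θ hθ => integral_traceRe_mul_exp_le hn hμ hD hTV hD1 hDinf hfs hfC hfh hA hfd hf0 hθ)
    ht).trans (le_of_eq ?_))
  congr 3
  ring

end Application

end MatrixBoundedDifferences


open MatrixBoundedDifferences in
open scoped Matrix.Norms.L2Operator in
theorem mainTheorem1 {Ω : Type*} [MeasurableSpace Ω] (P : Measure Ω) [IsProbabilityMeasure P]
    {n d : ℕ} (hd : 1 ≤ d)
    {Λ : Fin n → Type*} [∀ k, MeasurableSpace (Λ k)]
    (Z : ∀ k, Ω → Λ k) (hZ : ∀ k, Measurable (Z k))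
    (H : (∀ k, Λ k) → Matrix (Fin d) (Fin d) ℂ)
    (hHherm : ∀ z, (H z).IsHermitian)
    (hHmeas : ∀ i j, Measurable fun z => H z i j)
    (A : Fin n → Matrix (Fin d) (Fin d) ℂ) (hA : ∀ k, (A k).IsHermitian)
    (hdiff : ∀ (k : Fin n) (z : ∀ k, Λ k) (z' : Λ k),
      ((A k) ^ 2 - (H z - H (Function.update z k z')) ^ 2).PosSemidef)
    (X : Ω → Matrix (Fin d) (Fin d) ℂ) (hX : ∀ ω, X ω = H (fun k => Z k ω))
    (σsq : ℝ) (hσ : σsq = specNorm (∑ k, (A k) ^ 2)) :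
    -- the expectation of `H(Z)` exists
    (∀ i j, Integrable (fun ω => X ω i j) P) ∧
    -- the degenerate case, in which both bounds below have to be read as `0` for `t > 0`
    (σsq = 0 → ∀ t : ℝ, 0 < t →
      P.real {ω | t ≤ lambdaMax (X ω - matrixExpectation P X)} = 0) ∧
    -- independent variables
    (iIndepFun Z P → ∀ t : ℝ, 0 ≤ t →
      P.real {ω | t ≤ lambdaMax (X ω - matrixExpectation P X)} ≤
        d * Real.exp (-t ^ 2 / σsq)) ∧
    -- dependent variables
    ((∀ k, StandardBorelSpace (Λ k)) →
      ∀ D : Matrix (Fin n) (Fin n) ℝ, IsDobrushinMatrix P (fun ω k => Z k ω) D →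
      max (normOne D) (normInf D) < 1 →
      ∀ c : ℝ, c = (1 / (1 - normOne D) + 1 / (1 - normInf D)) / 2 →
      ∀ t : ℝ, 0 ≤ t →
      P.real {ω | t ≤ lambdaMax (X ω - matrixExpectation P X)} ≤
        d * Real.exp (-t ^ 2 / (c * σsq))) := by
  obtain rfl : X = fun ω => H (fun k => Z k ω) := funext hX
  have hosc := oscLE_of_posSemidef hHherm hA hdiff
  obtain ⟨C, hC⟩ := hosc.exists_norm_le
  have hint : Integrable (fun ω => H fun k => Z k ω) P :=
    Integrable.of_bound ((stronglyMeasurable_matrix hHmeas).comp_measurable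
      (measurable_pi_lambda _ hZ)).aestronglyMeasurable C
      (Filter.Eventually.of_forall fun _ => hC _)
  refine ⟨fun i j => (entryCLM i j).integrable_comp hint, fun h0 t ht => ?_,
    fun hind t ht => ?_, fun _ D hDob hmax c hc t ht => ?_⟩
  · -- all the `A k` vanish, hence `H` is constant
    have hA0 := eq_zero_of_sum_sq_eq_zero hA
      (norm_eq_zero.1 (by rw [← specNorm_eq_norm, ← hσ, h0]))
    have hconst : ∀ z z', H z = H z' := fun z z' => by
      have := hosc.norm_sub_le z z'
      simp only [hA0, norm_zero, Finset.sum_const_zero] at this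
      exact sub_eq_zero.1 (norm_le_zero_iff.1 this)
    have hset : {ω | t ≤ lambdaMax (H (fun k => Z k ω) -
        matrixExpectation P fun ω => H fun k => Z k ω)} = ∅ := by
      refine Set.eq_empty_of_forall_notMem fun ω hω => ?_
      have e : ∫ ω', H (fun k => Z k ω') ∂P = H fun k => Z k ω := by
        rw [integral_congr_ae (g := fun _ => H fun k => Z k ω)
          (Filter.Eventually.of_forall fun ω' => hconst _ _)]
        simp
      rw [Set.mem_ofPred_eq, matrixExpectation_eq_integral hint, e, sub_self,
        lambdaMax_zero hd] at hω
      linarith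
    rw [hset, measureReal_empty]
  · have : ∀ i, IsProbabilityMeasure (P.map (Z i)) := fun i =>
      Measure.isProbabilityMeasure_map (hZ i).aemeasurable
    have h1 : normOne (0 : Matrix (Fin n) (Fin n) ℝ) = 0 := by simp [normOne]
    have h2 : normInf (0 : Matrix (Fin n) (Fin n) ℝ) = 0 := by simp [normInf]
    have h := measureReal_lambdaMax_le_of_dobrushin hd hZ hHherm hHmeas hA hdiff
      (κ := fun i => Kernel.const _ (P.map (Z i)))
      (fun i => hasCondDistrib_const_of_iIndepFun hZ hind i) (D := 0) (fun _ _ => le_rfl)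
      (fun i z k y _ => by simp [dTV_self]) (by rw [h1]; exact one_pos)
      (by rw [h2]; exact one_pos) ht
    rw [h1, h2, ← hσ] at h
    norm_num at h
    exact h
  · obtain ⟨hD, -, κ, hκ⟩ := hDob
    have : ∀ i, IsMarkovKernel (κ i) := fun i => (hκ i).1
    rw [hσ, hc]
    refine measureReal_lambdaMax_le_of_dobrushin hd hZ hHherm hHmeas hA hdiff
      (fun i => (hκ i).2.1) hD (fun i z k y hk => ?_) ((le_max_left _ _).trans_lt hmax)
      ((le_max_right _ _).trans_lt hmax) ht
    refine ((hκ i).2.2 z (Function.update z k y)).trans ?_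
    rw [Finset.sum_eq_single k]
    · exact mul_le_of_le_one_right (hD i k) (by split_ifs <;> norm_num)
    · intro j _ hj
      simp [Function.update_of_ne hj]
    · simp
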